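/- Let $N\ge 2$ agents have initial states $y_i=\theta+w_i\in\mathbb R$, $i=1,\dots,N$, where $\theta\in\mathbb R$ and $w_1,\dots,w_N$ are independent $\mathcal N(0,\sigma_w^2)$ variables, with arbitrary $\sigma_w^2>0$. Let $\{d_{i,k}\}_{1\le i\le N,\,k\ge 0}$ be independent privacy noises, independent of $(w_1,\dots,w_N)$. In round $k$ agent $i$ transmits $z_{i,k}=M_{i,k}(y_i,(d_{i,0},\dots,d_{i,k}),\mathcal Z_{k-1})$, where $M_{i,k}$ is measurable and $\mathcal Z_{k-1}$ consists of all signals transmitted in rounds $0,\dots,k-1$; let $\mathcal Z=(z_{i,k})_{i,k}$ be all the information transmitted over the network (noises and signals live in standard Borel spaces). Put $\mathcal Y=(y_1,\dots,y_N)$. Let $S_1,\dots,S_N>0$, and suppose that the privacy constraints $\mathcal I_{\mathcal Z}(y_i)\le S_i$ hold for all $i$, in the following sense: the conditional laws of $\mathcal Z$ given $\mathcal Y=y$ have jointly measurable densities $p(z\mid y)$ with respect to a common $\sigma$-finite measure $\mu$; for each $i$ and each fixed choice of the other coordinates, $y_i\mapsto p(z\mid y)$ is locally absolutely continuous for $\mu$-almost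 every $z$; and $$\mathcal I_{\mathcal Z}(y_i)=\mathbb E\Big[\Big(\frac{\partial \ln p(\mathcal Z\mid y)}{\partial y_i}\Big)^2\,\Big|\,\mathcal Y=y\Big]\le S_i\qquad\text{for all } i \text{ and all } y\in\mathbb R^N .$$ Consider any consensus algorithm in which the state $x_{i,k}$ of agent $i$ after round $k$ is a measurable function of $y_i$, $d_{i,0},\dots,d_{i,k}$ and $\mathcal Z_k$, and suppose that for every $i$ the states $x_{i,k}$ converge in probability (for instance, almost surely), as $k\to\infty$, to one and the same integrable random variable $\bar y$ with $$\mathbb E[\bar y\mid\mathcal Y]=\frac1N\sum_{i=1}^N y_i \quad\text{almost surely.}$$ Then $$\mathbb E\Big(\bar y-\frac1N\sum_{i=1}^N y_i\Big)^2\ \ge\ \frac1{N^2}\sum_{i=1}^N\frac1{S_i}.$$ The bound holds for every $\sigma_w^2>0$, and hence also in the limit $\sigma_w^2\to\infty$. No condition on the mechanism beyond those above is needed. -/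

import Mathlib

open MeasureTheory ProbabilityTheory Filter
open scoped ENNReal NNReal Topology

namespace PrivacyConsensus

/-- A family of recursive stochastic obfuscation mechanisms for `N` agents. In round `k`, agent `i`
turns its sensitive initial state, its own privacy noises `d_{i,0}, …, d_{i,k}` and everything
transmitted by all agents in rounds `0, …, k - 1` into a new transmitted signal `z_{i,k}`.
`Ωd` is the space of the noises and `Ωz` the space of the signals. -/
structure Mechanism (N : ℕ) (Ωd Ωz : Type*) [MeasurableSpace Ωd] [MeasurableSpace Ωz] where
  /-- the map `M_{i,k}` -/
  map : Fin N → (k : ℕ) → ℝ → (Fin (k + 1) → Ωd) → (Fin k → Fin N → Ωz) → Ωz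
  measurable_map : ∀ i k, Measurable
    (fun q : ℝ × (Fin (k + 1) → Ωd) × (Fin k → Fin N → Ωz) => map i k q.1 q.2.1 q.2.2)

/-- The state-update rules of a distributed consensus algorithm driven by the transmitted signals:
the state `x_{i,k}` is computed from what agent `i` knows after round `k`, namely its own initial
state, its own privacy noises `d_{i,0}, …, d_{i,k}`, and the signals transmitted in rounds
`0, …, k`. (Rules that use the signals of neighbours only are the ones that ignore the other
signals.) -/
structure StateRule (N : ℕ) (Ωd Ωz : Type*) [MeasurableSpace Ωd] [MeasurableSpace Ωz] where
  /-- the map that computes `x_{i,k}` -/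
  map : Fin N → (k : ℕ) → ℝ → (Fin (k + 1) → Ωd) → (Fin (k + 1) → Fin N → Ωz) → ℝ
  measurable_map : ∀ i k, Measurable
    (fun q : ℝ × (Fin (k + 1) → Ωd) × (Fin (k + 1) → Fin N → Ωz) => map i k q.1 q.2.1 q.2.2)

variable {N : ℕ} {Ωd Ωz : Type*} [MeasurableSpace Ωd] [MeasurableSpace Ωz]

/-- All the information transmitted over the network: `transcript M y d k i` is the signal sent by
agent `i` in round `k` when the initial states are `y` and the privacy noises are `d`. -/
def transcript (M : Mechanism N Ωd Ωz) (y : Fin N → ℝ) (d : Fin N → ℕ → Ωd) :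
    ℕ → Fin N → Ωz
  | k => fun i => M.map i k (y i) (fun l : Fin (k + 1) => d i l)
      (fun l : Fin k => transcript M y d l)
termination_by k => k
decreasing_by exact l.2

theorem transcript_apply (M : Mechanism N Ωd Ωz) (y : Fin N → ℝ) (d : Fin N → ℕ → Ωd)
    (k : ℕ) (i : Fin N) :
    transcript M y d k i = M.map i k (y i) (fun l : Fin (k + 1) => d i l)
      (fun l : Fin k => transcript M y d l) := by
  rw [transcript]

/-- The transcript is a measurable function of the initial states and the noises, so that the laws
below are genuine push-forwards. -/
theorem measurable_transcript (M : Mechanism N Ωd Ωz) :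
    Measurable (fun q : (Fin N → ℝ) × (Fin N → ℕ → Ωd) => transcript M q.1 q.2) := by
  refine measurable_pi_iff.2 fun k => ?_
  induction k using Nat.strong_induction_on with
  | _ k ih =>
    refine measurable_pi_iff.2 fun i => ?_
    simp only [transcript_apply]
    refine (M.measurable_map i k).comp (Measurable.prodMk (by fun_prop) (Measurable.prodMk
      (by fun_prop) (measurable_pi_iff.2 fun l => ih l l.2)))

/-- The state `x_{i,k}` of agent `i` after round `k`. -/
def agentState (M : Mechanism N Ωd Ωz) (A : StateRule N Ωd Ωz) (y : Fin N → ℝ)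
    (d : Fin N → ℕ → Ωd) (i : Fin N) (k : ℕ) : ℝ :=
  A.map i k (y i) (fun l : Fin (k + 1) => d i l) (fun l : Fin (k + 1) => transcript M y d l)

/-- The conditional law of the transmitted information given that the vector of initial states
equals `y`. As the privacy noises `d` are independent of the initial states, this is the law of the
transcript with the initial states frozen at `y`. -/
noncomputable def transcriptLaw {Ω : Type*} [MeasurableSpace Ω] (P : Measure Ω)
    (M : Mechanism N Ωd Ωz) (d : Fin N → ℕ → Ω → Ωd) (y : Fin N → ℝ) :
    Measure (ℕ → Fin N → Ωz) :=
  P.map (fun ω => transcript M y (fun i k => d i k ω))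

/-- `p z y` is a version, regular in `y`, of the density at `z` of `Q y` with respect to the
reference measure `μ`: on each line parallel to a coordinate axis it is locally absolutely
continuous in the moving coordinate, for almost every `z`. This is the classical regularity under
which the score and the Fisher information are defined. -/
structure IsRegularDensity {Z : Type*} [MeasurableSpace Z] (Q : (Fin N → ℝ) → Measure Z)
    (μ : Measure Z) (p : Z → (Fin N → ℝ) → ℝ) : Prop where
  measurable : Measurable (fun q : Z × (Fin N → ℝ) => p q.1 q.2)
  nonneg : ∀ z y, 0 ≤ p z y
  density : ∀ y, Q y = μ.withDensity (fun z => ENNReal.ofReal (p z y))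
  absolutelyContinuous : ∀ (i : Fin N) (y : Fin N → ℝ), ∀ᵐ z ∂μ, ∀ a b : ℝ,
    AbsolutelyContinuousOnInterval (fun t => p z (Function.update y i t)) a b

/-- The score `∂ ln p(z | y) / ∂ y_i`. -/
noncomputable def score {Z : Type*} (p : Z → (Fin N → ℝ) → ℝ) (i : Fin N) (y : Fin N → ℝ)
    (z : Z) : ℝ :=
  deriv (fun t => Real.log (p z (Function.update y i t))) (y i)

/-- The Fisher information about `y_i`, `E[(∂ ln p(z | y) / ∂ y_i)² | y]`, as an extended
nonnegative number. -/
noncomputable def fisherInfo {Z : Type*} [MeasurableSpace Z] (Q : (Fin N → ℝ) → Measure Z)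
    (p : Z → (Fin N → ℝ) → ℝ) (i : Fin N) (y : Fin N → ℝ) : ℝ≥0∞ :=
  ∫⁻ z, ENNReal.ofReal ((score p i y z) ^ 2) ∂(Q y)

/-- The privacy constraints `I_Z(y_i) ≤ S_i` for all `i`: the Fisher information of the transmitted
information about each `y_i` is well defined and is at most `S_i`, whatever the initial states. -/
def SatisfiesPrivacy {Z : Type*} [MeasurableSpace Z] (Q : (Fin N → ℝ) → Measure Z)
    (S : Fin N → ℝ) : Prop :=
  ∃ (μ : Measure Z) (p : Z → (Fin N → ℝ) → ℝ), SigmaFinite μ ∧ IsRegularDensity Q μ p ∧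
    ∀ i y, fisherInfo Q p i y ≤ ENNReal.ofReal (S i)

end PrivacyConsensus

/-! Split the initial states as `y = a + b`, with `a` and `b` independent Gaussian of variances `σ²
- v₂` and `v₂` per coordinate, and disclose `a` along with the transcript; let `F` be the σ-algebra
of both. Given `F`, the private data of different agents stay independent: each signal is computed
from one agent's data and the public past, so publishing it never couples two agents
(`condIndepGiven_iSup_publicInfo`). The consensus limit is computable from `F` together with the
data of one agent, and also from `F` together with the data of another. Hence it is `F`-measurable
up to null sets (`CondIndepGiven.ae_eq_condExp`), and so is `W = ybar - average a`.

Put `T i = E[b i / v₂ | F]`. Three facts carry the bound. (1) `E[W * T i] = E[W * b i] / v₂ = 1 /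
N`. Indeed `W = r + average b`, where `r = ybar - average y` is centered given `(a, b)`, because the
privacy noises are independent of both; only `average b` correlates with `b i`. (2) The `T i` are
orthogonal, by conditional independence (`CondIndepGiven.integral_condExp_mul_condExp`). (3) `E[T i
^ 2] ≤ S i`. Gaussian integration by parts trades the factor `b i / v₂` for the score in `y i`,
whose second moment is the Fisher information (`integral_mul_world_perturbation_le`,
`integral_condExp_sq_le`).

A Bessel inequality (`sum_inv_le_integral_sq_of_orthogonal`) gives `E[W ^ 2] ≥ N⁻² ∑ 1 / S i`, while
`E[W ^ 2] = E[r ^ 2] + v₂ / N`. Since `v₂ > 0` may be taken arbitrarily small, the extra term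
disappears; without the splitting, `v₂ = σ²` would leave a loss of `σ² / N`. -/

namespace PrivacyConsensus

/-! ### Conditional independence through conditional expectations -/

section CondIndep

variable {Ω : Type*} {m₁ m₂ F U : MeasurableSpace Ω} {mΩ : MeasurableSpace Ω} {μ : Measure Ω}

/-- `m₁` and `m₂` are conditionally independent given `F`: adding `m₁` to the knowledge of `F` does
not change the conditional expectation of an `m₂`-measurable variable. -/
def CondIndepGiven {Ω : Type*} {mΩ : MeasurableSpace Ω} (μ : Measure Ω)
    (m₁ m₂ F : MeasurableSpace Ω) : Prop :=
  ∀ h : Ω → ℝ, Integrable h μ → StronglyMeasurable[m₂] h → μ[h | m₁ ⊔ F] =ᵐ[μ] μ[h | F]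

theorem CondIndepGiven.absorb (h : CondIndepGiven μ m₁ m₂ F) :
    CondIndepGiven μ (m₁ ⊔ F) m₂ F := by
  intro f hf hfm
  rw [sup_assoc, sup_idem]
  exact h f hf hfm

variable [IsFiniteMeasure μ]

theorem condIndepGiven_bot_of_indep (h₁ : m₁ ≤ mΩ) (h₂ : m₂ ≤ mΩ) [IsProbabilityMeasure μ]
    (h : Indep m₁ m₂ μ) : CondIndepGiven μ m₁ m₂ ⊥ := by
  intro f _ hfm
  rw [sup_bot_eq]
  refine (condExp_indep_eq h₂ h₁ hfm h.symm).trans ?_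
  rw [condExp_bot]

/-- With its primed companion, this is the self-adjointness of conditional expectation, in the
pairing of an integrable function with a bounded one. That pairing lets merely integrable functions
be tested against indicators. -/
theorem integral_mul_condExp_of_bound {f g : Ω → ℝ} {c : ℝ} (hF : F ≤ mΩ)
    (hf : Integrable f μ) (hgc : ∀ᵐ ω ∂μ, ‖g ω‖ ≤ c) :
    ∫ ω, f ω * μ[g | F] ω ∂μ = ∫ ω, μ[f | F] ω * μ[g | F] ω ∂μ := by
  have hbd : ∀ᵐ ω ∂μ, ‖μ[g | F] ω‖ ≤ c := ae_bdd_abs_condExp_of_ae_bdd_abs hgc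
  have hi : Integrable (f * μ[g | F]) μ :=
    hf.mul_bdd (c := c) integrable_condExp.aestronglyMeasurable hbd
  have := condExp_mul_of_stronglyMeasurable_right (m := F) stronglyMeasurable_condExp hi hf
  calc ∫ ω, f ω * μ[g | F] ω ∂μ = ∫ ω, μ[f * μ[g | F] | F] ω ∂μ := (integral_condExp hF).symm
    _ = _ := integral_congr_ae this

theorem integral_mul_condExp_of_bound' {f g : Ω → ℝ} {c : ℝ} (hF : F ≤ mΩ)
    (hg : Integrable g μ) (hgc : ∀ᵐ ω ∂μ, ‖g ω‖ ≤ c) :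
    ∫ ω, μ[f | F] ω * g ω ∂μ = ∫ ω, μ[f | F] ω * μ[g | F] ω ∂μ := by
  have hi : Integrable (μ[f | F] * g) μ :=
    integrable_condExp.mul_bdd (c := c) hg.aestronglyMeasurable hgc
  have := condExp_mul_of_stronglyMeasurable_left (m := F) stronglyMeasurable_condExp hi hg
  calc ∫ ω, μ[f | F] ω * g ω ∂μ = ∫ ω, μ[μ[f | F] * g | F] ω ∂μ := (integral_condExp hF).symm
    _ = _ := integral_congr_ae this

/-- The definition treats the two sides differently, but what it encodes is a symmetric bilinear
identity. Self-adjointness moves the conditioning on `m₁ ⊔ F` onto an `m₂`-measurable indicator,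
where it collapses to `F`, and then back onto `f`. -/
theorem CondIndepGiven.symm (h₁ : m₁ ≤ mΩ) (h₂ : m₂ ≤ mΩ) (hF : F ≤ mΩ)
    (h : CondIndepGiven μ m₁ m₂ F) : CondIndepGiven μ m₂ m₁ F := by
  intro f hf hfm
  have hle : m₂ ⊔ F ≤ mΩ := sup_le h₂ hF
  refine (ae_eq_condExp_of_forall_setIntegral_eq hle hf
    (fun s _ _ => integrable_condExp.integrableOn) (fun s hs _ => ?_)
    (StronglyMeasurable.aestronglyMeasurable
      (stronglyMeasurable_condExp.mono (le_sup_right : F ≤ m₂ ⊔ F)))).symm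
  -- Intersections `t ∩ u` with `t` in `m₂` and `u` in `F` form a π-system generating `m₂ ⊔ F`, so
  -- equality of the integrals need only be checked on them.
  have hpi : IsPiSystem
      (Set.image2 (· ∩ ·) {t | MeasurableSet[m₂] t} {u | MeasurableSet[F] u}) := by
    rintro _ ⟨t, ht, u, hu, rfl⟩ _ ⟨t', ht', u', hu', rfl⟩ _
    refine ⟨t ∩ t', MeasurableSet.inter ht ht', u ∩ u', MeasurableSet.inter hu hu', ?_⟩
    exact (Set.inter_inter_inter_comm _ _ _ _).symm
  have hgen : m₂ ⊔ F = MeasurableSpace.generateFrom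
      (Set.image2 (· ∩ ·) {t | MeasurableSet[m₂] t} {u | MeasurableSet[F] u}) := by
    refine le_antisymm (sup_le ?_ ?_) (MeasurableSpace.generateFrom_le ?_)
    · intro t ht
      exact MeasurableSpace.measurableSet_generateFrom
        ⟨t, ht, Set.univ, MeasurableSet.univ, by simp⟩
    · intro u hu
      exact MeasurableSpace.measurableSet_generateFrom
        ⟨Set.univ, MeasurableSet.univ, u, hu, by simp⟩
    · rintro _ ⟨t, ht, u, hu, rfl⟩
      exact MeasurableSet.inter ((le_sup_left : m₂ ≤ m₂ ⊔ F) _ ht)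
        ((le_sup_right : F ≤ m₂ ⊔ F) _ hu)
  have key : ∀ t u, MeasurableSet[m₂] t → MeasurableSet[F] u →
      ∫ ω in t ∩ u, μ[f | F] ω ∂μ = ∫ ω in t ∩ u, f ω ∂μ := by
    intro t u ht hu
    have ht' := h₂ _ ht
    have hu' := hF _ hu
    set g : Ω → ℝ := t.indicator 1 with hg
    have hgi : Integrable g μ := (integrable_const (1 : ℝ)).indicator ht'
    have hgb : ∀ᵐ ω ∂μ, ‖g ω‖ ≤ 1 := by
      refine ae_of_all _ fun ω => ?_
      simp only [hg, Set.indicator]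
      split_ifs <;> simp
    have hgm : StronglyMeasurable[m₂] g := stronglyMeasurable_const.indicator ht
    have hfu : Integrable (u.indicator f) μ := hf.indicator hu'
    have e1 : ∀ k : Ω → ℝ, ∫ ω in t ∩ u, k ω ∂μ = ∫ ω, u.indicator k ω * g ω ∂μ := by
      intro k
      rw [← integral_indicator (ht'.inter hu')]
      refine integral_congr_ae (ae_of_all _ fun ω => ?_)
      by_cases h1 : ω ∈ t <;> by_cases h2 : ω ∈ u <;> simp [hg, h1, h2]
    have hle1 : m₁ ⊔ F ≤ mΩ := sup_le h₁ hF
    have hfum : StronglyMeasurable[m₁ ⊔ F] (u.indicator f) :=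
      (hfm.mono le_sup_left).indicator ((le_sup_right : F ≤ m₁ ⊔ F) _ hu)
    have e2 : μ[u.indicator f | m₁ ⊔ F] = u.indicator f :=
      condExp_of_stronglyMeasurable hle1 hfum hfu
    have e3 : μ[u.indicator f | F] =ᵐ[μ] u.indicator μ[f | F] := condExp_indicator hf hu
    symm
    calc ∫ ω in t ∩ u, f ω ∂μ = ∫ ω, μ[u.indicator f | m₁ ⊔ F] ω * g ω ∂μ := by rw [e1, e2]
      _ = ∫ ω, u.indicator f ω * μ[g | m₁ ⊔ F] ω ∂μ := by
        rw [integral_mul_condExp_of_bound' hle1 hgi hgb,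
          integral_mul_condExp_of_bound hle1 hfu hgb]
      _ = ∫ ω, u.indicator f ω * μ[g | F] ω ∂μ := by
        refine integral_congr_ae ?_
        filter_upwards [h g hgi hgm] with ω hω
        rw [hω]
      _ = ∫ ω, μ[u.indicator f | F] ω * g ω ∂μ := by
        rw [integral_mul_condExp_of_bound' hF hgi hgb,
          integral_mul_condExp_of_bound hF hfu hgb]
      _ = ∫ ω, u.indicator μ[f | F] ω * g ω ∂μ := by
        refine integral_congr_ae ?_
        filter_upwards [e3] with ω hω
        rw [hω]
      _ = _ := (e1 _).symm
  induction s, hs using MeasurableSpace.induction_on_inter hgen hpi with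
  | empty => simp
  | basic s hs =>
    obtain ⟨t, ht, u, hu, rfl⟩ := hs
    exact key t u ht hu
  | compl t ht ih =>
    rw [setIntegral_compl (hle _ ht) integrable_condExp, setIntegral_compl (hle _ ht) hf,
      ih (measure_lt_top _ _), integral_condExp hF]
  | iUnion f' hd hm ih =>
    rw [integral_iUnion (fun n => hle _ (hm n)) hd integrable_condExp.integrableOn,
      integral_iUnion (fun n => hle _ (hm n)) hd hf.integrableOn]
    exact tsum_congr fun n => ih n (measure_lt_top _ _)

/-- Information that `m₁` can compute from what is public may be made public. -/
theorem CondIndepGiven.sup_right (h₁ : m₁ ≤ mΩ) (hF : F ≤ mΩ) (hU : U ≤ m₁ ⊔ F)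
    (h : CondIndepGiven μ m₁ m₂ F) : CondIndepGiven μ m₁ m₂ (F ⊔ U) := by
  intro f hf hfm
  have hle : m₁ ⊔ F ≤ mΩ := sup_le h₁ hF
  have e : m₁ ⊔ (F ⊔ U) = m₁ ⊔ F := by
    rw [← sup_assoc]
    exact sup_eq_left.2 hU
  have hFU : F ⊔ U ≤ m₁ ⊔ F := sup_le le_sup_right hU
  rw [e]
  calc μ[f | m₁ ⊔ F] =ᵐ[μ] μ[f | F] := h f hf hfm
    _ =ᵐ[μ] μ[μ[f | F] | F ⊔ U] := by
      rw [condExp_of_stronglyMeasurable (hFU.trans hle)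
        (stronglyMeasurable_condExp.mono le_sup_left) integrable_condExp]
    _ =ᵐ[μ] μ[μ[f | m₁ ⊔ F] | F ⊔ U] := condExp_congr_ae (h f hf hfm).symm
    _ =ᵐ[μ] μ[f | F ⊔ U] := condExp_condExp_of_le hFU hle

/-- Information that `m₂` can compute from what is public may be made public. -/
theorem CondIndepGiven.sup_right' (h₁ : m₁ ≤ mΩ) (h₂ : m₂ ≤ mΩ) (hF : F ≤ mΩ) (hU : U ≤ m₂ ⊔ F)
    (h : CondIndepGiven μ m₁ m₂ F) : CondIndepGiven μ m₁ m₂ (F ⊔ U) :=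
  ((h.symm h₁ h₂ hF).sup_right h₂ hF hU).symm h₂ h₁ (sup_le hF (hU.trans (sup_le h₂ hF)))

/-- Lévy's upward theorem applies to both filtrations `ℱ n` and `m₁ ⊔ ℱ n`; the two martingales
agree at every finite stage, hence so do their limits. -/
theorem CondIndepGiven.iSup {ℱ : ℕ → MeasurableSpace Ω} (hmono : Monotone ℱ) (h₁ : m₁ ≤ mΩ)
    (hle : ∀ n, ℱ n ≤ mΩ) (h : ∀ n, CondIndepGiven μ m₁ m₂ (ℱ n)) :
    CondIndepGiven μ m₁ m₂ (⨆ n, ℱ n) := by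
  intro f hf hfm
  let 𝒢 : Filtration ℕ mΩ := ⟨ℱ, hmono, hle⟩
  let 𝒢' : Filtration ℕ mΩ :=
    ⟨fun n => m₁ ⊔ ℱ n, fun _ _ hij => sup_le_sup_left (hmono hij) _, fun n => sup_le h₁ (hle n)⟩
  have e : m₁ ⊔ ⨆ n, ℱ n = ⨆ n, 𝒢' n := sup_iSup
  rw [e]
  have hall : ∀ᵐ ω ∂μ, ∀ n, μ[f | m₁ ⊔ ℱ n] ω = μ[f | ℱ n] ω :=
    ae_all_iff.2 fun n => h n f hf hfm
  filter_upwards [tendsto_ae_condExp (ℱ := 𝒢) (μ := μ) f,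
    tendsto_ae_condExp (ℱ := 𝒢') (μ := μ) f, hall] with ω h1 h2 h3
  exact tendsto_nhds_unique (h2.congr h3) h1

/-- What both sides can compute from the public information is public. -/
theorem CondIndepGiven.ae_eq_condExp (h₁ : m₁ ≤ mΩ) (h₂ : m₂ ≤ mΩ) (hF : F ≤ mΩ)
    (h : CondIndepGiven μ m₁ m₂ F) {g : Ω → ℝ} (hg : Integrable g μ)
    (hg₁ : AEStronglyMeasurable[m₁ ⊔ F] g μ) (hg₂ : AEStronglyMeasurable[m₂ ⊔ F] g μ) :
    g =ᵐ[μ] μ[g | F] := by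
  have h' : CondIndepGiven μ m₁ (m₂ ⊔ F) F :=
    ((h.symm h₁ h₂ hF).absorb).symm (sup_le h₂ hF) h₁ hF
  have hc : g =ᵐ[μ] hg₂.mk g := hg₂.ae_eq_mk
  calc g =ᵐ[μ] μ[g | m₁ ⊔ F] :=
        (condExp_of_aestronglyMeasurable' (sup_le h₁ hF) hg₁ hg).symm
    _ =ᵐ[μ] μ[hg₂.mk g | m₁ ⊔ F] := condExp_congr_ae hc
    _ =ᵐ[μ] μ[hg₂.mk g | F] := h' _ (hg.congr hc) hg₂.stronglyMeasurable_mk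
    _ =ᵐ[μ] μ[g | F] := condExp_congr_ae hc.symm

/-- Square-integrable version of the pull-out property, integrated. -/
theorem integral_mul_condExp_of_memLp {f g : Ω → ℝ} (hF : F ≤ mΩ)
    (hf : MemLp f 2 μ) (hg : MemLp g 2 μ) (hfm : AEStronglyMeasurable[F] f μ) :
    ∫ ω, f ω * μ[g | F] ω ∂μ = ∫ ω, f ω * g ω ∂μ := by
  have := condExp_mul_of_aestronglyMeasurable_left (m := F) hfm (hf.integrable_mul hg)
    (hg.integrable one_le_two)
  exact (integral_congr_ae this).symm.trans (integral_condExp hF)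

/-- Projection onto `F` preserves the inner product across the two sides. Independent perturbations
of different agents therefore stay orthogonal after projection. -/
theorem CondIndepGiven.integral_condExp_mul_condExp (h₁ : m₁ ≤ mΩ) (hF : F ≤ mΩ)
    (h : CondIndepGiven μ m₁ m₂ F) {f g : Ω → ℝ} (hf : MemLp f 2 μ) (hg : MemLp g 2 μ)
    (hfm : StronglyMeasurable[m₁] f) (hgm : StronglyMeasurable[m₂] g) :
    ∫ ω, μ[f | F] ω * μ[g | F] ω ∂μ = ∫ ω, f ω * g ω ∂μ := by
  have e := h g (hg.integrable one_le_two) hgm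
  rw [← integral_mul_condExp_of_memLp (sup_le h₁ hF) hf hg
    (hfm.mono (le_sup_left : m₁ ≤ m₁ ⊔ F)).aestronglyMeasurable]
  calc ∫ ω, μ[f | F] ω * μ[g | F] ω ∂μ = ∫ ω, μ[g | F] ω * μ[f | F] ω ∂μ := by
        simp only [mul_comm]
    _ = ∫ ω, μ[g | F] ω * f ω ∂μ :=
        integral_mul_condExp_of_memLp hF (hg.condExp one_le_two) hf
          stronglyMeasurable_condExp.aestronglyMeasurable
    _ = _ := by
        refine integral_congr_ae ?_
        filter_upwards [e] with ω hω
        rw [hω, mul_comm]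

end CondIndep

/-! ### Measurability of a derivative with respect to a measurable parameter -/

section Deriv

variable {Z : Type*} [MeasurableSpace Z]

/-- By compactness, the image of `K` lies in `U` exactly when its distance to the complement of `U`
is bounded below by some `1 / n`; by continuity this is decided on a countable dense subset of `K`.
-/
theorem measurableSet_mapsTo_of_isCompact {f : Z → C(ℝ, ℝ)} (hf : ∀ t, Measurable fun z => f z t)
    {K U : Set ℝ} (hK : IsCompact K) (hU : IsOpen U) :
    MeasurableSet {z | Set.MapsTo (f z) K U} := by
  obtain ⟨s, hs, hsd⟩ := TopologicalSpace.exists_countable_dense K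
  have e : {z | Set.MapsTo (f z) K U} =
      ⋃ n : ℕ, ⋂ t ∈ s, {z | (n : ℝ≥0∞)⁻¹ ≤ Metric.infEDist (f z (t : K)) Uᶜ} := by
    ext z
    have hcont : Continuous fun t : K => Metric.infEDist (f z t) Uᶜ :=
      Metric.continuous_infEDist.comp ((f z).continuous.comp continuous_subtype_val)
    simp only [Set.mem_ofPred_eq, Set.mem_iUnion, Set.mem_iInter]
    constructor
    · intro h
      rcases K.eq_empty_or_nonempty with rfl | hne
      · exact ⟨0, fun t => t.2.elim⟩
      have : CompactSpace K := isCompact_iff_compactSpace.1 hK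
      have : Nonempty K := hne.to_subtype
      obtain ⟨t₀, -, ht₀⟩ := isCompact_univ.exists_isMinOn Set.univ_nonempty hcont.continuousOn
      have hpos : Metric.infEDist (f z t₀) Uᶜ ≠ 0 := by
        intro h0
        exact (Metric.mem_iff_infEDist_zero_of_closed hU.isClosed_compl (x := f z t₀)).2 h0
          (h t₀.2)
      obtain ⟨n, hn⟩ := ENNReal.exists_inv_nat_lt hpos
      exact ⟨n, fun t _ => hn.le.trans (ht₀ (Set.mem_univ t))⟩
    · rintro ⟨n, hn⟩ t ht
      have hcl : IsClosed {t : K | (n : ℝ≥0∞)⁻¹ ≤ Metric.infEDist (f z t) Uᶜ} :=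
        isClosed_le continuous_const hcont
      have hall := hcl.closure_subset_iff.2 hn (hsd ⟨t, ht⟩)
      by_contra hcon
      have h0 : Metric.infEDist (f z t) Uᶜ = 0 := Metric.infEDist_zero_of_mem hcon
      have : (n : ℝ≥0∞)⁻¹ ≤ 0 := h0 ▸ hall
      simp at this
  rw [e]
  refine MeasurableSet.iUnion fun n => MeasurableSet.biInter hs fun t _ => ?_
  exact measurableSet_le measurable_const (Metric.continuous_infEDist.measurable.comp (hf t))

/-- The density is only measurable in `z`, whereas measurability of a parametric derivative is known
for jointly continuous dependence. The curve `f z` itself serves as the parameter: `z ↦ f z` is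
Borel into `C(ℝ, ℝ)` with the compact-open topology, where evaluation is jointly continuous. -/
theorem measurable_deriv_of_measurable_param {f : Z → ℝ → ℝ} (hf : ∀ t, Measurable fun z => f z t)
    (hc : ∀ z, Continuous (f z)) : Measurable fun q : Z × ℝ => deriv (f q.1) q.2 := by
  borelize C(ℝ, ℝ)
  let F : Z → C(ℝ, ℝ) := fun z => ⟨f z, hc z⟩
  have hF : Measurable F := by
    rw [BorelSpace.measurable_eq (α := C(ℝ, ℝ)),
      borel_eq_generateFrom_of_subbasis ContinuousMap.compactOpen_eq]
    refine measurable_generateFrom ?_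
    rintro _ ⟨K, hK, U, hU, rfl⟩
    exact measurableSet_mapsTo_of_isCompact (f := F) hf hK hU
  have hd : Measurable fun q : C(ℝ, ℝ) × ℝ => deriv (fun t => q.1 t) q.2 :=
    measurable_deriv_with_param (f := fun (φ : C(ℝ, ℝ)) (t : ℝ) => φ t)
      (by simpa [Function.uncurry_def] using ContinuousEval.continuous_eval)
  exact hd.comp ((hF.comp measurable_fst).prodMk measurable_snd)

end Deriv

/-! ### Gaussian integration by parts -/

section Gaussian

variable {m : ℝ} {v : ℝ≥0}

theorem hasDerivAt_gaussianPDFReal (hv : v ≠ 0) (t : ℝ) :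
    HasDerivAt (gaussianPDFReal m v) (-((t - m) / v * gaussianPDFReal m v t)) t := by
  have hv' : (v : ℝ) ≠ 0 := by exact_mod_cast hv
  have h1 : HasDerivAt (fun t : ℝ => -(t - m) ^ 2 / (2 * v)) (-((t - m) / v)) t := by
    refine ((((hasDerivAt_id t).sub_const m).fun_pow 2).fun_neg.div_const
      (2 * (v : ℝ))).congr_deriv ?_
    simp only [id, Nat.cast_ofNat]
    field_simp
    norm_num
  refine (h1.exp.const_mul (√(2 * Real.pi * v))⁻¹).congr_deriv ?_
  rw [gaussianPDFReal]
  ring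

/-- Stein's identity, under local absolute continuity and integrability alone; no decay of `f` at
infinity is assumed. -/
theorem integral_gaussianReal_mul_eq_integral_deriv (hv : v ≠ 0) {f : ℝ → ℝ}
    (hac : ∀ a b, AbsolutelyContinuousOnInterval f a b)
    (hf : Integrable f (gaussianReal m v))
    (hf' : Integrable (fun t => (t - m) / v * f t) (gaussianReal m v))
    (hd : Integrable (deriv f) (gaussianReal m v)) :
    ∫ t, (t - m) / v * f t ∂(gaussianReal m v) = ∫ t, deriv f t ∂(gaussianReal m v) := by
  set φ := gaussianPDFReal m v with hφ
  have hconv : ∀ {k : ℝ → ℝ}, Integrable k (gaussianReal m v) →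
      Integrable (fun t => φ t * k t) := by
    intro k hk
    rw [gaussianReal_of_var_ne_zero m hv, integrable_withDensity_iff_integrable_smul'
      (measurable_gaussianPDF m v) (ae_of_all _ fun _ => gaussianPDF_lt_top)] at hk
    simpa [hφ, toReal_gaussianPDF] using hk
  have hφd : ∀ t, HasDerivAt φ (-((t - m) / v * φ t)) t := hasDerivAt_gaussianPDFReal hv
  have hφac : ∀ a b, AbsolutelyContinuousOnInterval φ a b := by
    intro a b
    have : ContDiff ℝ 1 φ := by
      rw [hφ, gaussianPDFReal_def]
      fun_prop
    exact this.contDiffOn.absolutelyContinuousOnInterval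
  have hgac : ∀ a b, AbsolutelyContinuousOnInterval (fun t => φ t * f t) a b :=
    fun a b => (hφac a b).fun_mul (hac a b)
  have hfd : ∀ᵐ t : ℝ, DifferentiableAt ℝ f t := by
    have : ∀ n : ℕ, ∀ᵐ t : ℝ, t ∈ Set.uIcc (-(n : ℝ)) n → DifferentiableAt ℝ f t :=
      fun n => (hac _ _).ae_differentiableAt
    filter_upwards [ae_all_iff.2 this] with t ht
    obtain ⟨n, hn⟩ := exists_nat_ge |t|
    exact ht n (by rw [Set.uIcc_of_le (by simp)]; exact abs_le.1 hn)
  have hgd : ∀ᵐ t : ℝ, deriv (fun t => φ t * f t) t =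
      φ t * deriv f t - φ t * ((t - m) / v * f t) := by
    filter_upwards [hfd] with t ht
    rw [((hφd t).fun_mul ht.hasDerivAt).deriv]
    ring
  have hgi : Integrable (deriv fun t => φ t * f t) :=
    ((hconv hd).sub (hconv hf')).congr (hgd.mono fun t ht => ht.symm)
  have hlim : Tendsto (fun R : ℝ => φ R * f R - φ (-R) * f (-R)) atTop
      (𝓝 (∫ t, deriv (fun t => φ t * f t) t)) := by
    refine (intervalIntegral_tendsto_integral hgi tendsto_neg_atTop_atBot tendsto_id).congr
      fun R => ?_
    exact (hgac _ _).integral_deriv_eq_sub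
  -- The boundary term has a limit because the derivative is integrable, and it is itself an
  -- integrable function of `R`; the limit can only be zero.
  have hzero : ∫ t, deriv (fun t => φ t * f t) t = 0 := by
    refine IntegrableAtFilter.eq_zero_of_tendsto (μ := volume) (l := atTop) ?_ ?_ hlim
    · exact ((hconv hf).sub (hconv hf).comp_neg).integrableAtFilter _
    · intro s hs
      obtain ⟨a, ha⟩ := mem_atTop_sets.1 hs
      exact measure_mono_top (show Set.Ici a ⊆ s from fun x hx => ha x hx) Real.volume_Ici
  rw [integral_congr_ae hgd, integral_sub (hconv hd) (hconv hf'), sub_eq_zero] at hzero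
  rw [integral_gaussianReal_eq_integral_smul hv, integral_gaussianReal_eq_integral_smul hv]
  exact hzero.symm

end Gaussian

/-! ### The score identity on a line -/

section Score

/-- No differentiability is needed: where `f` is positive, `f = exp (log f)` nearby, so `f` and `log
f` are differentiable at the same points, and elsewhere both values of `deriv` are the default zero.
-/
theorem deriv_log_comp_of_pos {f : ℝ → ℝ} (hc : Continuous f) {t : ℝ} (ht : 0 < f t) :
    deriv (fun u => Real.log (f u)) t = deriv f t / f t := by
  by_cases hd : DifferentiableAt ℝ f t
  · exact deriv.log hd ht.ne'
  · have hd' : ¬ DifferentiableAt ℝ (fun u => Real.log (f u)) t := by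
      intro h
      refine hd (h.exp.congr_of_eventuallyEq ?_)
      filter_upwards [hc.continuousAt.eventually (lt_mem_nhds ht)] with u hu
      exact (Real.exp_log hu).symm
    rw [deriv_zero_of_not_differentiableAt hd, deriv_zero_of_not_differentiableAt hd', zero_div]

/-- With the convention `0 / 0 = 0`, this makes the relation "derivative = score × density" valid at
the zeros of the density too. -/
theorem deriv_eq_zero_of_nonneg_of_eq_zero {f : ℝ → ℝ} (h0 : ∀ t, 0 ≤ f t) {t : ℝ}
    (ht : f t = 0) : deriv f t = 0 :=
  IsLocalMin.deriv_eq_zero (Eventually.of_forall fun u => ht ▸ h0 u)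

variable {Z : Type*} [MeasurableSpace Z] {μ : Measure Z} [SigmaFinite μ] {f : Z → ℝ → ℝ}
  {m : ℝ} {v : ℝ≥0}

theorem integrable_prod_mul_of_lintegral_eq_one {γ : Measure ℝ} [SFinite γ]
    (hmeas : Measurable fun q : Z × ℝ => f q.1 q.2) (h0 : ∀ z t, 0 ≤ f z t)
    (h1 : ∀ t, ∫⁻ z, ENNReal.ofReal (f z t) ∂μ = 1) {k : ℝ → ℝ} (hk : Measurable k)
    (hki : Integrable k γ) :
    Integrable (fun q : Z × ℝ => k q.2 * f q.1 q.2) (μ.prod γ) := by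
  have hm : Measurable fun q : Z × ℝ => k q.2 * f q.1 q.2 := (hk.comp measurable_snd).mul hmeas
  refine ⟨hm.aestronglyMeasurable, ?_⟩
  have hf : ∀ t, Measurable fun z => ENNReal.ofReal (f z t) := fun t =>
    (hmeas.comp (measurable_id.prodMk measurable_const)).ennreal_ofReal
  rw [hasFiniteIntegral_iff_enorm, lintegral_prod_symm _ hm.enorm.aemeasurable]
  calc ∫⁻ t, ∫⁻ z, ‖k t * f z t‖ₑ ∂μ ∂γ = ∫⁻ t, ‖k t‖ₑ ∂γ := by
        refine lintegral_congr fun t => ?_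
        have : ∀ z, ‖k t * f z t‖ₑ = ‖k t‖ₑ * ENNReal.ofReal (f z t) := fun z => by
          rw [enorm_mul, Real.enorm_of_nonneg (h0 z t)]
        simp_rw [this]
        rw [lintegral_const_mul _ (hf t), h1, mul_one]
    _ < ⊤ := hki.2

/-- By Fubini the integration by parts is done in `t` for each fixed `z`, so no derivative is ever
taken under the integral over `z`. It replaces `(t - m) / v` by the score `s`, and `h * s ≤ (h ^ 2 +
s ^ 2) / 2` concludes. Unlike Cauchy–Schwarz, this form is affine in the averages and survives
further averaging. -/
theorem integral_centered_mul_le_of_forall_absolutelyContinuous (hv : v ≠ 0)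
    (hmeas : Measurable fun q : Z × ℝ => f q.1 q.2) (h0 : ∀ z t, 0 ≤ f z t)
    (h1 : ∀ t, ∫⁻ z, ENNReal.ofReal (f z t) ∂μ = 1)
    (hac : ∀ z a b, AbsolutelyContinuousOnInterval (f z) a b) {S : ℝ} (hS : 0 ≤ S)
    (hI : ∀ t, ∫⁻ z, ENNReal.ofReal ((deriv (fun u => Real.log (f z u)) t) ^ 2)
      ∂(μ.withDensity fun z => ENNReal.ofReal (f z t)) ≤ ENNReal.ofReal S)
    {h : Z → ℝ} (hh : Measurable h) {C : ℝ} (hC : ∀ z, |h z| ≤ C) :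
    ∫ t, (t - m) / v * ∫ z, h z * f z t ∂μ ∂(gaussianReal m v) ≤
      ((∫ t, ∫ z, h z ^ 2 * f z t ∂μ ∂(gaussianReal m v)) + S) / 2 := by
  set γ := gaussianReal m v with hγ
  have hcont : ∀ z, Continuous (f z) := fun z => by
    refine continuous_iff_continuousAt.2 fun t => ?_
    refine (hac z (t - 1) (t + 1)).continuousOn.continuousAt ?_
    rw [Set.uIcc_of_le (by linarith)]
    exact Icc_mem_nhds (by linarith) (by linarith)
  have hft : ∀ t, Measurable fun z => f z t := fun t =>
    hmeas.comp (measurable_id.prodMk measurable_const)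
  set D : Z → ℝ → ℝ := fun z t => deriv (f z) t with hD
  have hDm : Measurable fun q : Z × ℝ => D q.1 q.2 := measurable_deriv_of_measurable_param hft hcont
  set s : Z → ℝ → ℝ := fun z t => D z t / f z t with hs
  have hsm : Measurable fun q : Z × ℝ => s q.1 q.2 := hDm.div hmeas
  have hDs : ∀ z t, D z t = s z t * f z t := fun z t => by
    by_cases hz : f z t = 0
    · rw [hz, mul_zero]
      exact deriv_eq_zero_of_nonneg_of_eq_zero (h0 z) hz
    · exact (div_mul_cancel₀ _ hz).symm
  have hst : ∀ t, Measurable fun z => s z t := fun t =>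
    hsm.comp (measurable_id.prodMk measurable_const)
  have hI' : ∀ t, ∫⁻ z, ENNReal.ofReal (s z t ^ 2 * f z t) ∂μ ≤ ENNReal.ofReal S := by
    intro t
    refine le_trans (le_of_eq ?_) (hI t)
    have hae : ∀ᵐ z ∂(μ.withDensity fun z => ENNReal.ofReal (f z t)),
        ENNReal.ofReal ((deriv (fun u => Real.log (f z u)) t) ^ 2) =
          ENNReal.ofReal (s z t ^ 2) := by
      rw [ae_withDensity_iff (hft t).ennreal_ofReal]
      refine ae_of_all _ fun z hz => ?_
      have hpos : 0 < f z t := by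
        rwa [Ne, ENNReal.ofReal_eq_zero, not_le] at hz
      rw [deriv_log_comp_of_pos (hcont z) hpos]
    rw [lintegral_congr_ae hae, lintegral_withDensity_eq_lintegral_mul _ (hft t).ennreal_ofReal
      ((hst t).pow_const 2).ennreal_ofReal]
    refine lintegral_congr fun z => ?_
    rw [Pi.mul_apply, mul_comm (s z t ^ 2), ENNReal.ofReal_mul (h0 z t)]
  have i_f : Integrable (fun q : Z × ℝ => f q.1 q.2) (μ.prod γ) := by
    simpa using integrable_prod_mul_of_lintegral_eq_one (γ := γ) hmeas h0 h1
      (k := fun _ => 1) measurable_const (integrable_const _)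
  have i_id : Integrable (fun t : ℝ => (t - m) / v) γ := by
    have : Integrable (fun t : ℝ => t) γ :=
      (memLp_id_gaussianReal (μ := m) (v := v) 1).integrable le_rfl
    exact (this.sub (integrable_const m)).div_const _
  have i_tf : Integrable (fun q : Z × ℝ => (q.2 - m) / v * f q.1 q.2) (μ.prod γ) :=
    integrable_prod_mul_of_lintegral_eq_one hmeas h0 h1 (by fun_prop) i_id
  have i_s : Integrable (fun q : Z × ℝ => s q.1 q.2 ^ 2 * f q.1 q.2) (μ.prod γ) := by
    have hm : Measurable fun q : Z × ℝ => s q.1 q.2 ^ 2 * f q.1 q.2 := (hsm.pow_const 2).mul hmeas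
    refine ⟨hm.aestronglyMeasurable, ?_⟩
    rw [hasFiniteIntegral_iff_enorm, lintegral_prod_symm _ hm.enorm.aemeasurable]
    calc ∫⁻ t, ∫⁻ z, ‖s z t ^ 2 * f z t‖ₑ ∂μ ∂γ ≤ ∫⁻ _, ENNReal.ofReal S ∂γ := by
          refine lintegral_mono fun t => le_trans (le_of_eq ?_) (hI' t)
          refine lintegral_congr fun z => ?_
          rw [Real.enorm_of_nonneg (mul_nonneg (sq_nonneg _) (h0 z t))]
      _ < ⊤ := by simp
  -- Dominated through `|s| ≤ (1 + s ^ 2) / 2`: finite Fisher information gives integrability of the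
  -- derivative.
  have i_D : Integrable (fun q : Z × ℝ => D q.1 q.2) (μ.prod γ) := by
    refine ((i_f.add i_s).div_const 2).mono' hDm.aestronglyMeasurable (ae_of_all _ fun q => ?_)
    simp only [Pi.add_apply]
    rw [hDs, Real.norm_eq_abs, abs_mul, abs_of_nonneg (h0 q.1 q.2), ← sq_abs (s q.1 q.2)]
    nlinarith [mul_nonneg (sq_nonneg (|s q.1 q.2| - 1)) (h0 q.1 q.2)]
  have hbd : ∀ {k : Z × ℝ → ℝ}, Integrable k (μ.prod γ) →
      Integrable (fun q => h q.1 * k q) (μ.prod γ) := fun hk =>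
    hk.bdd_mul (c := C) (hh.comp measurable_fst).aestronglyMeasurable
      (ae_of_all _ fun q => hC q.1)
  have i_h2 : Integrable (fun q : Z × ℝ => h q.1 ^ 2 * f q.1 q.2) (μ.prod γ) := by
    simpa only [pow_two, mul_assoc] using hbd (hbd i_f)
  have hibp : ∀ᵐ z ∂μ, ∫ t, (t - m) / v * f z t ∂γ = ∫ t, D z t ∂γ := by
    filter_upwards [i_f.prod_right_ae, i_tf.prod_right_ae, i_D.prod_right_ae] with z hz1 hz2 hz3
    exact integral_gaussianReal_mul_eq_integral_deriv hv (hac z) hz1 hz2 hz3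
  calc ∫ t, (t - m) / v * ∫ z, h z * f z t ∂μ ∂γ
      = ∫ t, ∫ z, h z * ((t - m) / v * f z t) ∂μ ∂γ := by
        refine integral_congr_ae (ae_of_all _ fun t => ?_)
        simp only
        rw [← integral_const_mul]
        refine integral_congr_ae (ae_of_all _ fun z => ?_)
        simp only
        ring
    _ = ∫ z, ∫ t, h z * ((t - m) / v * f z t) ∂γ ∂μ :=
        (integral_integral_swap (f := fun z t => h z * ((t - m) / v * f z t)) (hbd i_tf)).symm
    _ = ∫ z, ∫ t, h z * D z t ∂γ ∂μ := by
        refine integral_congr_ae ?_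
        filter_upwards [hibp] with z hz
        rw [integral_const_mul, integral_const_mul, hz]
    _ = ∫ q, h q.1 * D q.1 q.2 ∂(μ.prod γ) := (integral_prod _ (hbd i_D)).symm
    _ ≤ ∫ q, (h q.1 ^ 2 * f q.1 q.2 + s q.1 q.2 ^ 2 * f q.1 q.2) / 2 ∂(μ.prod γ) := by
        refine integral_mono (hbd i_D) ((i_h2.add i_s).div_const 2) fun q => ?_
        simp only
        rw [hDs]
        nlinarith [mul_nonneg (sq_nonneg (h q.1 - s q.1 q.2)) (h0 q.1 q.2)]
    _ = ((∫ t, ∫ z, h z ^ 2 * f z t ∂μ ∂γ) + ∫ t, ∫ z, s z t ^ 2 * f z t ∂μ ∂γ) / 2 := by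
        rw [integral_div, integral_add i_h2 i_s, integral_prod_symm _ i_h2,
          integral_prod_symm _ i_s]
    _ ≤ _ := by
        have : ∫ t, ∫ z, s z t ^ 2 * f z t ∂μ ∂γ ≤ ∫ _, S ∂γ := by
          refine integral_mono i_s.integral_prod_right (integrable_const _) fun t => ?_
          simp only
          rw [integral_eq_lintegral_of_nonneg_ae
            (ae_of_all _ fun z => mul_nonneg (sq_nonneg _) (h0 z t))
            (((hst t).pow_const 2).mul (hft t)).aestronglyMeasurable]
          exact ENNReal.toReal_le_of_le_ofReal hS (hI' t)
        simp only [integral_const, probReal_univ, smul_eq_mul, one_mul] at this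
        linarith

/-- The exceptional set of `z` does not depend on `t`, so setting the density to zero on a
measurable null superset changes no integral. -/
theorem integral_centered_mul_le (hv : v ≠ 0)
    (hmeas : Measurable fun q : Z × ℝ => f q.1 q.2) (h0 : ∀ z t, 0 ≤ f z t)
    (h1 : ∀ t, ∫⁻ z, ENNReal.ofReal (f z t) ∂μ = 1)
    (hac : ∀ᵐ z ∂μ, ∀ a b, AbsolutelyContinuousOnInterval (f z) a b) {S : ℝ} (hS : 0 ≤ S)
    (hI : ∀ t, ∫⁻ z, ENNReal.ofReal ((deriv (fun u => Real.log (f z u)) t) ^ 2)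
      ∂(μ.withDensity fun z => ENNReal.ofReal (f z t)) ≤ ENNReal.ofReal S)
    {h : Z → ℝ} (hh : Measurable h) {C : ℝ} (hC : ∀ z, |h z| ≤ C) :
    ∫ t, (t - m) / v * ∫ z, h z * f z t ∂μ ∂(gaussianReal m v) ≤
      ((∫ t, ∫ z, h z ^ 2 * f z t ∂μ ∂(gaussianReal m v)) + S) / 2 := by
  classical
  obtain ⟨B, hBsub, hBm, hB0⟩ := exists_measurable_superset_of_null (ae_iff.1 hac)
  set g : Z → ℝ → ℝ := fun z t => if z ∈ B then 0 else f z t with hg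
  have hBae : ∀ᵐ z ∂μ, z ∉ B := measure_eq_zero_iff_ae_notMem.1 hB0
  have hgf : ∀ᵐ z ∂μ, g z = f z := by
    filter_upwards [hBae] with z hz
    funext t
    simp [hg, hz]
  have hgm : Measurable fun q : Z × ℝ => g q.1 q.2 :=
    Measurable.ite (measurable_fst hBm) measurable_const hmeas
  have hden : ∀ t, (μ.withDensity fun z => ENNReal.ofReal (g z t)) =
      μ.withDensity fun z => ENNReal.ofReal (f z t) := fun t => by
    refine withDensity_congr_ae ?_
    filter_upwards [hgf] with z hz
    rw [hz]
  have main := integral_centered_mul_le_of_forall_absolutelyContinuous (μ := μ) (f := g) (m := m)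
    hv hgm (fun z t => by simp only [hg]; split_ifs; exacts [le_rfl, h0 z t])
    (fun t => by
      rw [← h1 t]
      refine lintegral_congr_ae ?_
      filter_upwards [hgf] with z hz
      rw [hz])
    (fun z a b => by
      by_cases hz : z ∈ B
      · have : g z = fun _ => 0 := by funext t; simp [hg, hz]
        rw [this]
        exact contDiff_const.contDiffOn.absolutelyContinuousOnInterval
      · have : g z = f z := by funext t; simp [hg, hz]
        rw [this]
        by_contra hcon
        exact hz (hBsub fun hall => hcon (hall a b)))
    hS
    (fun t => by
      rw [hden]
      refine le_trans (le_of_eq (lintegral_congr_ae ?_)) (hI t)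
      filter_upwards [(withDensity_absolutelyContinuous μ _).ae_le hgf] with z hz
      rw [hz])
    hh hC
  have e : ∀ (k : Z → ℝ) (t : ℝ), ∫ z, k z * g z t ∂μ = ∫ z, k z * f z t ∂μ := fun k t => by
    refine integral_congr_ae ?_
    filter_upwards [hgf] with z hz
    rw [hz]
  simpa only [e] using main

end Score

/-! ### Products of families of measures -/

section Products

theorem iIndepFun_of_measurePreserving_pi {ι Ω : Type*} [Fintype ι] [MeasurableSpace Ω]
    {P : Measure Ω} [IsProbabilityMeasure P] {α : ι → Type*} [∀ i, MeasurableSpace (α i)]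
    {X : ∀ i, Ω → α i} {μ : ∀ i, Measure (α i)} [∀ i, IsProbabilityMeasure (μ i)]
    (h : MeasurePreserving (fun ω i => X i ω) P (Measure.pi μ)) : iIndepFun X P := by
  have hX : ∀ i, Measurable (X i) := fun i => (measurable_pi_apply i).comp h.measurable
  rw [iIndepFun_iff_map_fun_eq_pi_map fun i => (hX i).aemeasurable, h.map_eq]
  congr 1
  funext i
  exact (((measurePreserving_eval μ i).comp h).map_eq).symm

variable {ι α β δ : Type*} [Fintype ι] [MeasurableSpace α] [MeasurableSpace β] [MeasurableSpace δ]

theorem measurePreserving_pi_prod (μ : ι → Measure α) (ν : ι → Measure β)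
    [∀ i, SigmaFinite (μ i)] [∀ i, SigmaFinite (ν i)] :
    MeasurePreserving (fun (q : (ι → α) × (ι → β)) i => (q.1 i, q.2 i))
      ((Measure.pi μ).prod (Measure.pi ν)) (Measure.pi fun i => (μ i).prod (ν i)) :=
  (measurePreserving_arrowProdEquivProdArrow α β ι μ ν).symm

theorem measurePreserving_pi_prod_prod (μ : ι → Measure α) (ν : ι → Measure β)
    (ρ : ι → Measure δ) [∀ i, SigmaFinite (μ i)] [∀ i, SigmaFinite (ν i)]
    [∀ i, SigmaFinite (ρ i)] :
    MeasurePreserving (fun (q : (ι → α) × (ι → β) × (ι → δ)) i => (q.1 i, q.2.1 i, q.2.2 i))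
      ((Measure.pi μ).prod ((Measure.pi ν).prod (Measure.pi ρ)))
      (Measure.pi fun i => (μ i).prod ((ν i).prod (ρ i))) :=
  (measurePreserving_pi_prod μ fun i => (ν i).prod (ρ i)).comp
    ((MeasurePreserving.id (Measure.pi μ)).prod (measurePreserving_pi_prod ν ρ))

theorem measurePreserving_pi_add (m₁ m₂ : ℝ) (v₁ v₂ : ℝ≥0) :
    MeasurePreserving (fun q : (ι → ℝ) × (ι → ℝ) => q.1 + q.2)
      ((Measure.pi fun _ => gaussianReal m₁ v₁).prod (Measure.pi fun _ => gaussianReal m₂ v₂))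
      (Measure.pi fun _ => gaussianReal (m₁ + m₂) (v₁ + v₂)) := by
  have h : MeasurePreserving (fun q : ℝ × ℝ => q.1 + q.2)
      ((gaussianReal m₁ v₁).prod (gaussianReal m₂ v₂)) (gaussianReal (m₁ + m₂) (v₁ + v₂)) :=
    ⟨by fun_prop, gaussianReal_conv_gaussianReal⟩
  exact (measurePreserving_pi _ _ fun _ : ι => h).comp (measurePreserving_pi_prod _ _)

/-- Resampling one coordinate independently leaves a product law unchanged; this isolates the
integration over that coordinate. -/
theorem measurePreserving_update [DecidableEq ι] (μ : ι → Measure α)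
    [∀ i, IsProbabilityMeasure (μ i)] (i : ι) :
    MeasurePreserving (fun q : (ι → α) × α => Function.update q.1 i q.2)
      ((Measure.pi μ).prod (μ i)) (Measure.pi μ) := by
  have hm : Measurable fun q : (ι → α) × α => Function.update q.1 i q.2 := by
    refine measurable_pi_iff.2 fun j => ?_
    by_cases hj : j = i
    · subst hj
      simpa using measurable_snd
    · simpa [hj, Function.comp_def] using
        (measurable_pi_apply j).comp (measurable_fst (α := ι → α) (β := α))
  refine ⟨hm, (Measure.pi_eq fun s hs => ?_).symm⟩
  rw [Measure.map_apply hm (MeasurableSet.univ_pi hs)]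
  have e : (fun q : (ι → α) × α => Function.update q.1 i q.2) ⁻¹' Set.univ.pi s =
      (Set.univ.pi (Function.update s i Set.univ)) ×ˢ s i := by
    ext q
    simp only [Set.mem_preimage, Set.mem_pi, Set.mem_univ, true_imp_iff, Set.mem_prod]
    constructor
    · intro h
      refine ⟨fun j => ?_, by simpa using h i⟩
      by_cases hj : j = i
      · subst hj
        simp
      · simpa [hj] using h j
    · rintro ⟨h, hi⟩ j
      by_cases hj : j = i
      · subst hj
        simpa using hi
      · simpa [hj] using h j
  rw [e, Measure.prod_prod, Measure.pi_pi, ← Finset.mul_prod_erase _ _ (Finset.mem_univ i),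
    ← Finset.mul_prod_erase _ (fun j => μ j (s j)) (Finset.mem_univ i)]
  rw [Function.update_self, measure_univ, one_mul, mul_comm]
  congr 1
  refine Finset.prod_congr rfl fun j hj => ?_
  rw [Function.update_of_ne (Finset.ne_of_mem_erase hj)]

theorem gaussianReal_map_add_left (a : ℝ) (v : ℝ≥0) :
    (gaussianReal 0 v).map (fun t => a + t) = gaussianReal a v := by
  rw [gaussianReal_map_const_add, zero_add]

end Products

/-! ### The privacy constraint, integrated against a Gaussian initial state -/

section Privacy

variable {N : ℕ} {Z : Type*} [MeasurableSpace Z] {Q : (Fin N → ℝ) → Measure Z} {μ : Measure Z}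
  {p : Z → (Fin N → ℝ) → ℝ}

theorem IsRegularDensity.measurable_right (hp : IsRegularDensity Q μ p) (y : Fin N → ℝ) :
    Measurable fun z => p z y :=
  hp.measurable.comp (measurable_id.prodMk measurable_const)

theorem IsRegularDensity.integral_eq (hp : IsRegularDensity Q μ p) (y : Fin N → ℝ) (h : Z → ℝ) :
    ∫ z, h z ∂(Q y) = ∫ z, h z * p z y ∂μ := by
  rw [hp.density y, integral_withDensity_eq_integral_toReal_smul
    (hp.measurable_right y).ennreal_ofReal (ae_of_all _ fun z => ENNReal.ofReal_lt_top)]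
  refine integral_congr_ae (ae_of_all _ fun z => ?_)
  simp only [smul_eq_mul]
  rw [ENNReal.toReal_ofReal (hp.nonneg z y), mul_comm]

variable [SigmaFinite μ]

theorem IsRegularDensity.integral_line_le [∀ y, IsProbabilityMeasure (Q y)]
    (hp : IsRegularDensity Q μ p) {i : Fin N} {S : ℝ} (hS : 0 ≤ S)
    (hI : ∀ y, fisherInfo Q p i y ≤ ENNReal.ofReal S) {h : Z → ℝ} (hh : Measurable h) {C : ℝ}
    (hC : ∀ z, |h z| ≤ C) {v : ℝ≥0} (hv : v ≠ 0) (y : Fin N → ℝ) (m : ℝ) :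
    ∫ t, (t - m) / v * ∫ z, h z ∂(Q (Function.update y i t)) ∂(gaussianReal m v) ≤
      ((∫ t, ∫ z, h z ^ 2 ∂(Q (Function.update y i t)) ∂(gaussianReal m v)) + S) / 2 := by
  have hmeas : Measurable fun q : Z × ℝ => p q.1 (Function.update y i q.2) :=
    hp.measurable.comp (measurable_fst.prodMk ((measurable_update y).comp measurable_snd))
  have := integral_centered_mul_le (μ := μ) (f := fun z t => p z (Function.update y i t)) (m := m)
    hv hmeas (fun z t => hp.nonneg _ _)
    (fun t => by
      have h1 := measure_univ (μ := Q (Function.update y i t))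
      rwa [hp.density, withDensity_apply _ MeasurableSet.univ, Measure.restrict_univ] at h1)
    (hp.absolutelyContinuous i y) hS
    (fun t => by
      have := hI (Function.update y i t)
      simp only [fisherInfo, score, Function.update_idem, Function.update_self] at this
      rwa [hp.density] at this)
    hh hC
  simpa only [hp.integral_eq] using this

/-- After resampling `b i`, the inner integral runs along the line through `a + b` in direction `i`,
with a Gaussian centered at `a i`. There the one-dimensional bound applies, and it is then averaged
over `b`. -/
theorem IsRegularDensity.integral_gaussian_le [∀ y, IsProbabilityMeasure (Q y)]
    (hp : IsRegularDensity Q μ p) {i : Fin N} {S : ℝ} (hS : 0 ≤ S)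
    (hI : ∀ y, fisherInfo Q p i y ≤ ENNReal.ofReal S) {h : Z → ℝ} (hh : Measurable h) {C : ℝ}
    (hC : ∀ z, |h z| ≤ C) {v : ℝ≥0} (hv : v ≠ 0)
    (hm₁ : Measurable fun y => ∫ z, h z ∂(Q y)) (hm₂ : Measurable fun y => ∫ z, h z ^ 2 ∂(Q y))
    (a : Fin N → ℝ) :
    ∫ b, b i / v * ∫ z, h z ∂(Q (a + b)) ∂(Measure.pi fun _ => gaussianReal 0 v) ≤
      ((∫ b, ∫ z, h z ^ 2 ∂(Q (a + b)) ∂(Measure.pi fun _ => gaussianReal 0 v)) + S) / 2 := by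
  set γ := gaussianReal 0 v with hγ
  set Γ : Measure (Fin N → ℝ) := Measure.pi fun _ => γ with hΓ
  have hmp : MeasurePreserving (fun q : (Fin N → ℝ) × ℝ => Function.update q.1 i q.2)
      (Γ.prod γ) Γ := measurePreserving_update (fun _ => γ) i
  have hupd : ∀ (b : Fin N → ℝ) (t : ℝ),
      a + Function.update b i t = Function.update (a + b) i (a i + t) := by
    intro b t
    funext j
    by_cases hj : j = i
    · subst hj
      simp
    · simp [hj]
  have hb₁ : ∀ y, ‖∫ z, h z ∂(Q y)‖ ≤ C := fun y => by
    simpa using norm_integral_le_of_norm_le_const (μ := Q y) (f := h) (C := C) (ae_of_all _ hC)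
  have hb₂ : ∀ y, ‖∫ z, h z ^ 2 ∂(Q y)‖ ≤ C ^ 2 := fun y => by
    have : ∀ z, ‖h z ^ 2‖ ≤ C ^ 2 := fun z => by
      rw [norm_pow]
      exact pow_le_pow_left₀ (norm_nonneg _) (hC z) 2
    simpa using norm_integral_le_of_norm_le_const (μ := Q y) (ae_of_all _ this)
  set H₁ : (Fin N → ℝ) → ℝ := fun y => ∫ z, h z ∂(Q y) with hH₁
  set H₂ : (Fin N → ℝ) → ℝ := fun y => ∫ z, h z ^ 2 ∂(Q y) with hH₂
  have i_id : Integrable (fun t : ℝ => t / v) γ :=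
    ((memLp_id_gaussianReal (μ := 0) (v := v) 1).integrable le_rfl).div_const _
  have hid : Integrable (fun q : (Fin N → ℝ) × ℝ => q.2 / v) (Γ.prod γ) := i_id.comp_snd Γ
  have hma : Measurable fun q : (Fin N → ℝ) × ℝ => a + Function.update q.1 i q.2 :=
    measurable_const.add hmp.measurable
  have i₁ : Integrable (fun q : (Fin N → ℝ) × ℝ => q.2 / v * H₁ (a + Function.update q.1 i q.2))
      (Γ.prod γ) :=
    hid.mul_bdd (c := C) (hm₁.comp hma).aestronglyMeasurable (ae_of_all _ fun q => hb₁ _)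
  have i₂ : Integrable (fun q : (Fin N → ℝ) × ℝ => H₂ (a + Function.update q.1 i q.2))
      (Γ.prod γ) :=
    Integrable.of_bound (hm₂.comp hma).aestronglyMeasurable (C ^ 2) (ae_of_all _ fun q => hb₂ _)
  have e₁ : ∫ b, b i / v * H₁ (a + b) ∂Γ =
      ∫ b, ∫ t, t / v * H₁ (a + Function.update b i t) ∂γ ∂Γ := by
    rw [← integral_prod _ i₁, ← hmp.map_eq, integral_map hmp.measurable.aemeasurable]
    · simp only [Function.update_self, hmp.map_eq]
    · exact (((measurable_pi_apply i).div_const _).mul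
        (hm₁.comp (measurable_const_add a))).aestronglyMeasurable
  have e₂ : ∫ b, H₂ (a + b) ∂Γ = ∫ b, ∫ t, H₂ (a + Function.update b i t) ∂γ ∂Γ := by
    rw [← integral_prod _ i₂, ← hmp.map_eq, integral_map hmp.measurable.aemeasurable]
    · simp only [hmp.map_eq]
    · exact (hm₂.comp (measurable_const_add a)).aestronglyMeasurable
  have hline : ∀ b : Fin N → ℝ, ∫ t, t / v * H₁ (a + Function.update b i t) ∂γ ≤
      ((∫ t, H₂ (a + Function.update b i t) ∂γ) + S) / 2 := by
    intro b
    have := hp.integral_line_le hS hI hh hC hv (a + b) (a i)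
    have hmu : Measurable fun t : ℝ => Function.update (a + b) i t := measurable_update _
    rw [← gaussianReal_map_add_left, integral_map (by fun_prop), integral_map (by fun_prop)] at this
    · simpa only [hupd, add_sub_cancel_left] using this
    · exact (hm₂.comp hmu).aestronglyMeasurable
    · exact (((measurable_id.sub_const _).div_const _).mul (hm₁.comp hmu)).aestronglyMeasurable
  rw [e₁, e₂]
  calc ∫ b, ∫ t, t / v * H₁ (a + Function.update b i t) ∂γ ∂Γ
      ≤ ∫ b, ((∫ t, H₂ (a + Function.update b i t) ∂γ) + S) / 2 ∂Γ :=
        integral_mono i₁.integral_prod_left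
          ((i₂.integral_prod_left.add (integrable_const S)).div_const 2) hline
    _ = _ := by
        rw [integral_div, integral_add i₂.integral_prod_left (integrable_const S)]
        simp

end Privacy

/-! ### A product space carrying a two-stage initial state -/

section World

variable {N : ℕ} {Ωd Ωz : Type*} [MeasurableSpace Ωd] [MeasurableSpace Ωz]

theorem measurable_transcript_right (M : Mechanism N Ωd Ωz) (y : Fin N → ℝ) :
    Measurable (transcript M y) :=
  (measurable_transcript M).comp (measurable_const.prodMk measurable_id)

/-- Outcomes `(a, b, d)`: the initial states are `a + b`, the privacy noises are `d`. -/
abbrev World (N : ℕ) (Ωd : Type*) : Type _ := (Fin N → ℝ) × (Fin N → ℝ) × (Fin N → ℕ → Ωd)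

/-- The three components are independent, `a` and `b` being Gaussian with independent entries. -/
noncomputable def worldMeasure (θ : ℝ) (v₁ v₂ : ℝ≥0) (ν : Fin N → Measure (ℕ → Ωd)) :
    Measure (World N Ωd) :=
  (Measure.pi fun _ => gaussianReal θ v₁).prod
    ((Measure.pi fun _ => gaussianReal 0 v₂).prod (Measure.pi ν))

instance (θ : ℝ) (v₁ v₂ : ℝ≥0) (ν : Fin N → Measure (ℕ → Ωd)) [∀ i, IsProbabilityMeasure (ν i)] :
    IsProbabilityMeasure (worldMeasure θ v₁ v₂ ν) := by
  unfold worldMeasure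
  infer_instance

theorem measurePreserving_world_add (θ : ℝ) (v₁ v₂ : ℝ≥0) (ν : Fin N → Measure (ℕ → Ωd))
    [∀ i, IsProbabilityMeasure (ν i)] :
    MeasurePreserving (fun ω : World N Ωd => (ω.1 + ω.2.1, ω.2.2)) (worldMeasure θ v₁ v₂ ν)
      ((Measure.pi fun _ => gaussianReal θ (v₁ + v₂)).prod (Measure.pi ν)) := by
  have h1 := measurePreserving_pi_add (ι := Fin N) θ 0 v₁ v₂
  rw [add_zero] at h1
  have h2 := (measurePreserving_prodAssoc (Measure.pi fun _ : Fin N => gaussianReal θ v₁)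
    (Measure.pi fun _ : Fin N => gaussianReal 0 v₂) (Measure.pi ν)).symm
  exact (h1.prod (MeasurePreserving.id (Measure.pi ν))).comp h2

/-- Everything that agent `i` knows initially. -/
def agentInfo (i : Fin N) (ω : World N Ωd) : ℝ × ℝ × (ℕ → Ωd) := (ω.1 i, ω.2.1 i, ω.2.2 i)

theorem measurable_agentInfo (i : Fin N) : Measurable (agentInfo (Ωd := Ωd) i) := by
  unfold agentInfo
  fun_prop

theorem iIndepFun_agentInfo (θ : ℝ) (v₁ v₂ : ℝ≥0) (ν : Fin N → Measure (ℕ → Ωd))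
    [∀ i, IsProbabilityMeasure (ν i)] :
    iIndepFun (fun i => agentInfo (Ωd := Ωd) i) (worldMeasure θ v₁ v₂ ν) :=
  iIndepFun_of_measurePreserving_pi (measurePreserving_pi_prod_prod _ _ _)

/-- The σ-algebra of the initial knowledge of agent `i`. -/
@[reducible]
def privateInfo (Ωd : Type*) [MeasurableSpace Ωd] (i : Fin N) : MeasurableSpace (World N Ωd) :=
  MeasurableSpace.comap (agentInfo i) inferInstance

/-- The σ-algebra of the initial knowledge of all agents but `i`. -/
@[reducible]
def othersInfo (Ωd : Type*) [MeasurableSpace Ωd] (i : Fin N) : MeasurableSpace (World N Ωd) :=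
  ⨆ j ∈ ({i}ᶜ : Set (Fin N)), privateInfo Ωd j

theorem privateInfo_le (i : Fin N) :
    privateInfo Ωd i ≤ (inferInstance : MeasurableSpace (World N Ωd)) :=
  (measurable_agentInfo i).comap_le

theorem othersInfo_le (i : Fin N) :
    othersInfo Ωd i ≤ (inferInstance : MeasurableSpace (World N Ωd)) :=
  iSup₂_le fun j _ => privateInfo_le j

theorem privateInfo_le_othersInfo {i j : Fin N} (h : j ≠ i) :
    privateInfo Ωd j ≤ othersInfo Ωd i :=
  le_iSup₂_of_le j (by simpa using h) le_rfl

theorem indep_privateInfo_othersInfo (θ : ℝ) (v₁ v₂ : ℝ≥0) (ν : Fin N → Measure (ℕ → Ωd))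
    [∀ i, IsProbabilityMeasure (ν i)] (i : Fin N) :
    Indep (privateInfo Ωd i) (othersInfo Ωd i) (worldMeasure θ v₁ v₂ ν) := by
  have h := indep_iSup_of_disjoint (fun j => privateInfo_le (Ωd := Ωd) j)
    (iIndepFun_agentInfo θ v₁ v₂ ν) (disjoint_compl_right (a := ({i} : Set (Fin N))))
  simpa [othersInfo] using h

/-- The transcript, on the product space. -/
def worldTranscript (M : Mechanism N Ωd Ωz) (ω : World N Ωd) : ℕ → Fin N → Ωz :=
  transcript M (ω.1 + ω.2.1) ω.2.2

theorem measurable_worldTranscript (M : Mechanism N Ωd Ωz) : Measurable (worldTranscript M) :=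
  (measurable_transcript M).comp (by fun_prop : Measurable fun ω : World N Ωd =>
    (ω.1 + ω.2.1, ω.2.2))

/-- The σ-algebra of `a` and of the signals transmitted before round `n`. -/
@[reducible]
def publicInfo (M : Mechanism N Ωd Ωz) : ℕ → MeasurableSpace (World N Ωd)
  | 0 => MeasurableSpace.comap (fun ω => ω.1) inferInstance
  | n + 1 => publicInfo M n ⊔ MeasurableSpace.comap (fun ω => worldTranscript M ω n) inferInstance

theorem publicInfo_mono (M : Mechanism N Ωd Ωz) : Monotone (publicInfo M) :=
  monotone_nat_of_le_succ fun _ => le_sup_left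

theorem publicInfo_le_comap (M : Mechanism N Ωd Ωz) (n : ℕ) :
    publicInfo M n ≤ MeasurableSpace.comap
      (fun ω => (ω.1, worldTranscript M ω)) inferInstance := by
  have hpair := comap_measurable (m := inferInstance)
    (fun ω : World N Ωd => (ω.1, worldTranscript M ω))
  induction n with
  | zero => exact (measurable_fst.comp hpair).comap_le
  | succ n ih =>
    exact sup_le ih (((measurable_pi_apply n).comp (measurable_snd.comp hpair)).comap_le)

theorem publicInfo_le (M : Mechanism N Ωd Ωz) (n : ℕ) :
    publicInfo M n ≤ (inferInstance : MeasurableSpace (World N Ωd)) :=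
  (publicInfo_le_comap M n).trans
    (measurable_fst.prodMk (measurable_worldTranscript M)).comap_le

theorem measurable_worldTranscript_of_lt (M : Mechanism N Ωd Ωz) {k n : ℕ} (h : k < n) :
    Measurable[publicInfo M n] fun ω => worldTranscript M ω k :=
  ((comap_measurable (m := inferInstance) fun ω : World N Ωd => worldTranscript M ω k).mono
    le_sup_right le_rfl).mono (publicInfo_mono M h) le_rfl

theorem measurable_privateInfo_state (i : Fin N) :
    Measurable[privateInfo Ωd i] fun ω : World N Ωd => (ω.1 + ω.2.1) i := by
  have h : Measurable[privateInfo Ωd i] (agentInfo i) := comap_measurable _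
  exact h.fst.add h.snd.fst

theorem measurable_privateInfo_noise (i : Fin N) (k : ℕ) :
    Measurable[privateInfo Ωd i] fun (ω : World N Ωd) (l : Fin (k + 1)) => ω.2.2 i l := by
  have h : Measurable[privateInfo Ωd i] (agentInfo i) := comap_measurable _
  have h' : Measurable fun (e : ℕ → Ωd) (l : Fin (k + 1)) => e l :=
    measurable_pi_iff.2 fun l => measurable_pi_apply _
  exact h'.comp h.snd.snd

theorem measurable_transcript_entry (M : Mechanism N Ωd Ωz) (i : Fin N) (n : ℕ) :
    Measurable[privateInfo Ωd i ⊔ publicInfo M n] fun ω => worldTranscript M ω n i := by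
  simp only [worldTranscript, transcript_apply M _ _ n i]
  refine (M.measurable_map i n).comp (Measurable.prodMk ?_ (Measurable.prodMk ?_ ?_))
  · exact (measurable_privateInfo_state i).mono le_sup_left le_rfl
  · exact (measurable_privateInfo_noise i n).mono le_sup_left le_rfl
  · refine @measurable_pi_lambda _ _ _ (_) _ _ fun l => ?_
    exact (measurable_worldTranscript_of_lt M l.2).mono le_sup_right le_rfl

theorem measurable_agentState_world (M : Mechanism N Ωd Ωz) (A : StateRule N Ωd Ωz) (i : Fin N)
    (k : ℕ) : Measurable[privateInfo Ωd i ⊔ ⨆ n, publicInfo M n]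
      fun ω : World N Ωd => agentState M A (ω.1 + ω.2.1) ω.2.2 i k := by
  refine (A.measurable_map i k).comp (Measurable.prodMk ?_ (Measurable.prodMk ?_ ?_))
  · exact (measurable_privateInfo_state i).mono le_sup_left le_rfl
  · exact (measurable_privateInfo_noise i k).mono le_sup_left le_rfl
  · refine @measurable_pi_lambda _ _ _ (_) _ _ fun l => ?_
    exact (measurable_worldTranscript_of_lt M l.2).mono
      ((le_iSup (publicInfo M) (k + 1)).trans le_sup_right) le_rfl

/-- One round of communication. The entry of agent `i` is computable on its own side and all other
entries on the opposite side, so they are published in two moves, each preserving conditional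
independence. -/
theorem CondIndepGiven.sup_comap_pi {P : Measure (World N Ωd)} [IsFiniteMeasure P] {β : Type*}
    [MeasurableSpace β] {F : MeasurableSpace (World N Ωd)} {i : Fin N}
    (hF : F ≤ Prod.instMeasurableSpace)
    (h : CondIndepGiven P (privateInfo Ωd i) (othersInfo Ωd i) F)
    {f : World N Ωd → Fin N → β}
    (hf : ∀ j, MeasurableSpace.comap (fun ω => f ω j) inferInstance ≤ privateInfo Ωd j ⊔ F) :
    CondIndepGiven P (privateInfo Ωd i) (othersInfo Ωd i)
      (F ⊔ MeasurableSpace.comap f inferInstance) := by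
  set c : Fin N → MeasurableSpace (World N Ωd) :=
    fun j => MeasurableSpace.comap (fun ω => f ω j) inferInstance with hc
  have e : F ⊔ MeasurableSpace.comap f inferInstance =
      (F ⊔ c i) ⊔ ⨆ j ∈ ({i}ᶜ : Set (Fin N)), c j := by
    have e1 : MeasurableSpace.comap f inferInstance = ⨆ j, c j := by
      rw [show (inferInstance : MeasurableSpace (Fin N → β)) = MeasurableSpace.pi from rfl,
        MeasurableSpace.pi, MeasurableSpace.comap_iSup]
      simp only [MeasurableSpace.comap_comp]
      rfl
    rw [e1, sup_assoc]
    congr 1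
    refine le_antisymm (iSup_le fun j => ?_)
      (sup_le (le_iSup c i) (iSup₂_le fun j _ => le_iSup c j))
    by_cases hj : j = i
    · subst hj
      exact le_sup_left
    · exact le_sup_of_le_right (le_iSup₂_of_le j (by simpa using hj) le_rfl)
  rw [e]
  refine (h.sup_right (privateInfo_le i) hF (hf i)).sup_right' (privateInfo_le i)
    (othersInfo_le i) (sup_le hF ((hf i).trans (sup_le (privateInfo_le i) hF)))
    (iSup₂_le fun j hj => ?_)
  exact (hf j).trans (sup_le_sup (privateInfo_le_othersInfo (by simpa using hj)) le_sup_left)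

/-- The analogue of the rectangle property of communication protocols. Disclosing `a` counts as a
preliminary round in which each agent reveals its own coordinate. -/
theorem condIndepGiven_publicInfo (M : Mechanism N Ωd Ωz) (θ : ℝ) (v₁ v₂ : ℝ≥0)
    (ν : Fin N → Measure (ℕ → Ωd)) [∀ i, IsProbabilityMeasure (ν i)] (i : Fin N) (n : ℕ) :
    CondIndepGiven (worldMeasure θ v₁ v₂ ν) (privateInfo Ωd i) (othersInfo Ωd i)
      (publicInfo M n) := by
  induction n with
  | zero =>
    have h0 := condIndepGiven_bot_of_indep (privateInfo_le i) (othersInfo_le i)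
      (indep_privateInfo_othersInfo θ v₁ v₂ ν i)
    have := h0.sup_comap_pi bot_le (f := fun ω => ω.1) fun j => by
      have h : Measurable[privateInfo Ωd j] (agentInfo j) := comap_measurable _
      exact h.fst.comap_le.trans le_sup_left
    rwa [bot_sup_eq] at this
  | succ n ih =>
    exact ih.sup_comap_pi (publicInfo_le M n) (f := fun ω => worldTranscript M ω n)
      fun j => (measurable_transcript_entry M j n).comap_le

theorem condIndepGiven_iSup_publicInfo (M : Mechanism N Ωd Ωz) (θ : ℝ) (v₁ v₂ : ℝ≥0)
    (ν : Fin N → Measure (ℕ → Ωd)) [∀ i, IsProbabilityMeasure (ν i)] (i : Fin N) :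
    CondIndepGiven (worldMeasure θ v₁ v₂ ν) (privateInfo Ωd i) (othersInfo Ωd i)
      (⨆ n, publicInfo M n) :=
  CondIndepGiven.iSup (publicInfo_mono M) (privateInfo_le i) (publicInfo_le M)
    (condIndepGiven_publicInfo M θ v₁ v₂ ν i)

end World

/-! ### The lower bound on the product space -/

section Core

/-- A Cramér–Rao type inequality: a variable that has covariance `c` with each member of an
orthogonal family of square norms at most `S i` has square norm at least `c² ∑ 1 / S i`. -/
theorem sum_inv_le_integral_sq_of_orthogonal {ι Ω : Type*} [Fintype ι] [MeasurableSpace Ω]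
    {P : Measure Ω} {W : Ω → ℝ} {T : ι → Ω → ℝ} {S : ι → ℝ} {c : ℝ}
    (hS : ∀ i, 0 < S i) (hW : MemLp W 2 P) (hT : ∀ i, MemLp (T i) 2 P)
    (hWT : ∀ i, ∫ ω, W ω * T i ω ∂P = c)
    (horth : ∀ i j, i ≠ j → ∫ ω, T i ω * T j ω ∂P = 0)
    (hTS : ∀ i, ∫ ω, T i ω ^ 2 ∂P ≤ S i) :
    c ^ 2 * ∑ i, 1 / S i ≤ ∫ ω, W ω ^ 2 ∂P := by
  classical
  -- These weights give `E[W * U] = c * ∑ 1 / S i` and `E[U ^ 2] ≤ ∑ 1 / S i`, so that `E[(W - c *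
  -- U) ^ 2] ≥ 0` is already the claim.
  set U : Ω → ℝ := fun ω => ∑ i, 1 / S i * T i ω with hU
  have hUm : MemLp U 2 P := memLp_finsetSum _ fun i _ => (hT i).const_mul _
  have iWT : ∀ i, Integrable (fun ω => W ω * T i ω) P := fun i => hW.integrable_mul (hT i)
  have iTT : ∀ i j, Integrable (fun ω => T i ω * T j ω) P := fun i j => (hT i).integrable_mul (hT j)
  have iWU : Integrable (fun ω => W ω * U ω) P := hW.integrable_mul hUm
  have hWU : ∫ ω, W ω * U ω ∂P = c * ∑ i, 1 / S i := by
    have : ∀ ω, W ω * U ω = ∑ i, 1 / S i * (W ω * T i ω) := fun ω => by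
      rw [hU, Finset.mul_sum]
      exact Finset.sum_congr rfl fun i _ => by ring
    simp_rw [this]
    rw [integral_finsetSum _ fun i _ => (iWT i).const_mul _, Finset.mul_sum]
    exact Finset.sum_congr rfl fun i _ => by rw [integral_const_mul, hWT, mul_comm]
  have hUU : ∫ ω, U ω ^ 2 ∂P ≤ ∑ i, 1 / S i := by
    have : ∀ ω, U ω ^ 2 = ∑ i, ∑ j, 1 / S i * (1 / S j) * (T i ω * T j ω) := fun ω => by
      rw [pow_two, hU, Finset.sum_mul_sum]
      exact Finset.sum_congr rfl fun i _ => Finset.sum_congr rfl fun j _ => by ring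
    simp_rw [this]
    rw [integral_finsetSum _ fun i _ => integrable_finsetSum _ fun j _ =>
      (iTT i j).const_mul _]
    refine Finset.sum_le_sum fun i _ => ?_
    rw [integral_finsetSum _ fun j _ => (iTT i j).const_mul _,
      Finset.sum_eq_single i]
    · rw [integral_const_mul]
      simp_rw [← pow_two]
      calc (1 / S i) ^ 2 * ∫ ω, T i ω ^ 2 ∂P ≤ (1 / S i) ^ 2 * S i :=
            mul_le_mul_of_nonneg_left (hTS i) (sq_nonneg _)
        _ = 1 / S i := by
            have := (hS i).ne'
            field_simp
    · intro j _ hj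
      rw [integral_const_mul, horth i j hj.symm, mul_zero]
    · simp
  have hpos : 0 ≤ ∫ ω, (W ω - c * U ω) ^ 2 ∂P := integral_nonneg fun ω => sq_nonneg _
  have hexp : ∫ ω, (W ω - c * U ω) ^ 2 ∂P =
      ∫ ω, W ω ^ 2 ∂P - 2 * c * ∫ ω, W ω * U ω ∂P + c ^ 2 * ∫ ω, U ω ^ 2 ∂P := by
    have : ∀ ω, (W ω - c * U ω) ^ 2 = W ω ^ 2 - 2 * c * (W ω * U ω) + c ^ 2 * U ω ^ 2 :=
      fun ω => by ring
    simp_rw [this]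
    have i₁ : Integrable (fun ω => W ω ^ 2 - 2 * c * (W ω * U ω)) P :=
      hW.integrable_sq.sub (iWU.const_mul _)
    rw [integral_add i₁ (hUm.integrable_sq.const_mul _), integral_sub hW.integrable_sq
      (iWU.const_mul _), integral_const_mul, integral_const_mul]
  rw [hexp, hWU] at hpos
  nlinarith [mul_le_mul_of_nonneg_left hUU (sq_nonneg c)]

/-- A conditional expectation has square norm at most `S` as soon as the linear functional that it
represents satisfies the corresponding linear bound on bounded functions. -/
theorem integral_condExp_sq_le {Ω E : Type*} {F : MeasurableSpace Ω} {mΩ : MeasurableSpace Ω}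
    [MeasurableSpace E] {P : Measure Ω} [IsFiniteMeasure P] {X : Ω → E} (hX : Measurable X)
    (hF : F ≤ MeasurableSpace.comap X inferInstance) {u : Ω → ℝ} (hu : MemLp u 2 P) {S : ℝ}
    (h : ∀ k : E → ℝ, Measurable k → (∃ C, ∀ e, |k e| ≤ C) →
      ∫ ω, k (X ω) * u ω ∂P ≤ ((∫ ω, k (X ω) ^ 2 ∂P) + S) / 2) :
    ∫ ω, P[u | F] ω ^ 2 ∂P ≤ S := by
  have hFm : F ≤ mΩ := hF.trans hX.comap_le
  set T := P[u | F] with hT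
  have hTm : StronglyMeasurable[F] T := stronglyMeasurable_condExp
  have hT2 : MemLp T 2 P := hu.condExp one_le_two
  obtain ⟨k, hk, hkT⟩ := (hTm.mono hF).exists_eq_measurable_comp
  -- Truncation to zero, rather than to `±n`, gives `c n x * x = c n x ^ 2`. Testing with `c n ∘ k`
  -- thus yields `E[c n T ^ 2] ≤ (E[c n T ^ 2] + S) / 2`, and `n → ∞` follows by domination.
  let c : ℕ → ℝ → ℝ := fun n x => if |x| ≤ n then x else 0
  have hc : ∀ n, Measurable (c n) := fun n =>
    Measurable.ite (measurableSet_le measurable_norm measurable_const) measurable_id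
      measurable_const
  have hcn : ∀ n x, |c n x| ≤ n := fun n x => by
    simp only [c]
    split_ifs with hx
    · exact hx
    · simp
  have hcx : ∀ n x, |c n x| ≤ |x| := fun n x => by
    simp only [c]
    split_ifs with hx
    · exact le_rfl
    · simp
  have hcc : ∀ n x, c n x * x = c n x ^ 2 := fun n x => by
    simp only [c]
    split_ifs with hx
    · ring
    · simp
  have hbound : ∀ n : ℕ, ∫ ω, c n (T ω) ^ 2 ∂P ≤ S := by
    intro n
    have hcT : StronglyMeasurable[F] fun ω => c n (T ω) :=
      ((hc n).comp hTm.measurable).stronglyMeasurable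
    have hcT2 : MemLp (fun ω => c n (T ω)) 2 P :=
      hT2.mono (hcT.mono hFm).aestronglyMeasurable (ae_of_all _ fun ω => hcx n _)
    have h1 := h (fun e => c n (k e)) ((hc n).comp hk.measurable) ⟨n, fun e => hcn n _⟩
    have h2 : ∀ ω, k (X ω) = T ω := fun ω => by rw [hkT]; rfl
    simp only [h2] at h1
    rw [← integral_mul_condExp_of_memLp hFm hcT2 hu hcT.aestronglyMeasurable] at h1
    simp only [← hT, hcc] at h1
    linarith
  refine le_of_tendsto' (tendsto_integral_of_dominated_convergence (fun ω => T ω ^ 2)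
    (fun n => ?_) hT2.integrable_sq (fun n => ae_of_all _ fun ω => ?_)
    (ae_of_all _ fun ω => ?_)) hbound
  · exact (((hc n).comp (hTm.mono hFm).measurable).pow_const 2).aestronglyMeasurable
  · rw [Real.norm_eq_abs, abs_pow, ← sq_abs (T ω)]
    exact pow_le_pow_left₀ (abs_nonneg _) (hcx n _) 2
  · refine tendsto_const_nhds.congr' ?_
    obtain ⟨n, hn⟩ := exists_nat_ge |T ω|
    filter_upwards [eventually_ge_atTop n] with l hl
    have : |T ω| ≤ l := hn.trans (by exact_mod_cast hl)
    simp [c, this]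

end Core

/-! ### Moments of the perturbation `b` and its correlation with public information -/

section Bound

variable {N : ℕ} {Ωd Ωz : Type*} [MeasurableSpace Ωd] [MeasurableSpace Ωz]

/-- The average of the initial states. -/
noncomputable def average (y : Fin N → ℝ) : ℝ := (1 / (N : ℝ)) * ∑ i, y i

theorem average_add (x y : Fin N → ℝ) : average (x + y) = average x + average y := by
  simp only [average, Pi.add_apply, Finset.sum_add_distrib, mul_add]

theorem measurable_average : Measurable (average (N := N)) := by
  unfold average
  fun_prop

variable {θ : ℝ} {v₁ v₂ : ℝ≥0} {ν : Fin N → Measure (ℕ → Ωd)} [∀ i, IsProbabilityMeasure (ν i)]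

theorem measurePreserving_world_perturbation (i : Fin N) :
    MeasurePreserving (fun ω : World N Ωd => ω.2.1 i) (worldMeasure θ v₁ v₂ ν)
      (gaussianReal 0 v₂) :=
  (measurePreserving_eval (fun _ : Fin N => gaussianReal 0 v₂) i).comp
    (measurePreserving_fst.comp measurePreserving_snd)

theorem memLp_world_perturbation (i : Fin N) :
    MemLp (fun ω : World N Ωd => ω.2.1 i) 2 (worldMeasure θ v₁ v₂ ν) :=
  (memLp_id_gaussianReal (μ := 0) (v := v₂) 2).comp_measurePreserving
    (measurePreserving_world_perturbation i)

theorem integral_world_perturbation (i : Fin N) :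
    ∫ ω, ω.2.1 i ∂(worldMeasure θ v₁ v₂ ν) = 0 := by
  have h := measurePreserving_world_perturbation (θ := θ) (v₁ := v₁) (v₂ := v₂) (ν := ν) i
  rw [← integral_map (f := fun t : ℝ => t) h.measurable.aemeasurable
    measurable_id.aestronglyMeasurable, h.map_eq, integral_id_gaussianReal]

theorem integral_world_perturbation_sq (i : Fin N) :
    ∫ ω, ω.2.1 i * ω.2.1 i ∂(worldMeasure θ v₁ v₂ ν) = v₂ := by
  have h := measurePreserving_world_perturbation (θ := θ) (v₁ := v₁) (v₂ := v₂) (ν := ν) i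
  rw [← integral_map (f := fun t : ℝ => t * t) h.measurable.aemeasurable
    (by fun_prop), h.map_eq]
  have := variance_fun_id_gaussianReal (μ := 0) (v := v₂)
  rw [variance_of_integral_eq_zero aemeasurable_id' integral_id_gaussianReal] at this
  simpa only [pow_two] using this

theorem integral_world_perturbation_mul {i j : Fin N} (hij : i ≠ j) :
    ∫ ω, ω.2.1 i * ω.2.1 j ∂(worldMeasure θ v₁ v₂ ν) = 0 := by
  have h := ((iIndepFun_agentInfo θ v₁ v₂ ν).indepFun hij).comp
    (φ := fun q : ℝ × ℝ × (ℕ → Ωd) => q.2.1) (ψ := fun q : ℝ × ℝ × (ℕ → Ωd) => q.2.1)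
    (by fun_prop) (by fun_prop)
  have := h.integral_fun_mul_eq_mul_integral
    (memLp_world_perturbation i).aestronglyMeasurable
    (memLp_world_perturbation j).aestronglyMeasurable
  refine this.trans ?_
  rw [show (∫ ω, ((fun q : ℝ × ℝ × (ℕ → Ωd) => q.2.1) ∘ agentInfo i) ω
    ∂(worldMeasure θ v₁ v₂ ν)) = 0 from integral_world_perturbation i, zero_mul]

theorem integral_average_mul_world_perturbation (i : Fin N) :
    ∫ ω, average ω.2.1 * ω.2.1 i ∂(worldMeasure θ v₁ v₂ ν) = v₂ / N := by
  have e : ∀ ω : World N Ωd, average ω.2.1 * ω.2.1 i =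
      ∑ j, 1 / (N : ℝ) * (ω.2.1 j * ω.2.1 i) := fun ω => by
    rw [average, mul_assoc, Finset.sum_mul, Finset.mul_sum]
  have hint : ∀ j, Integrable (fun ω : World N Ωd => ω.2.1 j * ω.2.1 i)
      (worldMeasure θ v₁ v₂ ν) := fun j =>
    (memLp_world_perturbation j).integrable_mul (memLp_world_perturbation i)
  simp_rw [e]
  rw [integral_finsetSum _ fun j _ => (hint j).const_mul _, Finset.sum_eq_single i]
  · rw [integral_const_mul, integral_world_perturbation_sq]
    ring
  · intro j _ hj
    rw [integral_const_mul, integral_world_perturbation_mul hj, mul_zero]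
  · simp

theorem memLp_average_world_perturbation :
    MemLp (fun ω : World N Ωd => average ω.2.1) 2 (worldMeasure θ v₁ v₂ ν) :=
  (memLp_finsetSum _ fun i _ => memLp_world_perturbation i).const_mul _

theorem integral_average_world_perturbation_sq (hN : N ≠ 0) :
    ∫ ω, average ω.2.1 ^ 2 ∂(worldMeasure θ v₁ v₂ ν) = v₂ / N := by
  have e : ∀ ω : World N Ωd, average ω.2.1 ^ 2 =
      ∑ j, 1 / (N : ℝ) * (average ω.2.1 * ω.2.1 j) := fun ω => by
    rw [← Finset.mul_sum, ← Finset.mul_sum, pow_two]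
    conv_lhs => rw [average, mul_comm, ← average]
    rw [average]
    ring
  have hint : ∀ j, Integrable (fun ω : World N Ωd => average ω.2.1 * ω.2.1 j)
      (worldMeasure θ v₁ v₂ ν) := fun j =>
    memLp_average_world_perturbation.integrable_mul (memLp_world_perturbation j)
  simp_rw [e]
  rw [integral_finsetSum _ fun j _ => (hint j).const_mul _]
  simp only [integral_const_mul, integral_average_mul_world_perturbation, Finset.sum_const,
    Finset.card_univ, Fintype.card_fin, nsmul_eq_mul]
  have : (N : ℝ) ≠ 0 := by exact_mod_cast hN
  field_simp

/-- What is centered given the initial states is uncorrelated with the perturbation. -/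
theorem integral_mul_world_perturbation_eq_zero
    {R : (Fin N → ℝ) × (Fin N → ℕ → Ωd) → ℝ}
    (hR : MemLp R 2 ((Measure.pi fun _ => gaussianReal θ (v₁ + v₂)).prod (Measure.pi ν)))
    (hR0 : ∀ᵐ y ∂(Measure.pi fun _ : Fin N => gaussianReal θ (v₁ + v₂)),
      ∫ δ, R (y, δ) ∂(Measure.pi ν) = 0) (i : Fin N) :
    ∫ ω, R (ω.1 + ω.2.1, ω.2.2) * ω.2.1 i ∂(worldMeasure θ v₁ v₂ ν) = 0 := by
  have hint : Integrable (fun ω : World N Ωd => R (ω.1 + ω.2.1, ω.2.2) * ω.2.1 i)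
      (worldMeasure θ v₁ v₂ ν) :=
    (hR.comp_measurePreserving (measurePreserving_world_add θ v₁ v₂ ν)).integrable_mul
      (memLp_world_perturbation i)
  have hassoc := measurePreserving_prodAssoc (Measure.pi fun _ : Fin N => gaussianReal θ v₁)
    (Measure.pi fun _ : Fin N => gaussianReal 0 v₂) (Measure.pi ν)
  have hint' : Integrable (fun x : ((Fin N → ℝ) × (Fin N → ℝ)) × (Fin N → ℕ → Ωd) =>
      R (x.1.1 + x.1.2, x.2) * x.1.2 i) _ := hassoc.integrable_comp_of_integrable hint
  have hadd := measurePreserving_pi_add (ι := Fin N) θ 0 v₁ v₂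
  rw [add_zero] at hadd
  refine (hassoc.integral_comp' _).symm.trans ((integral_prod _ hint').trans ?_)
  refine integral_eq_zero_of_ae ?_
  filter_upwards [hadd.quasiMeasurePreserving.ae hR0] with q hq
  change ∫ δ, R (q.1 + q.2, δ) * q.2 i ∂(Measure.pi ν) = 0
  rw [integral_mul_const, hq, zero_mul]

/-- Test functions may depend on the disclosed `a`: it is frozen first, and since the privacy bound
is uniform in the initial states, the inequality for fixed `a` can be integrated over `a`. -/
theorem integral_mul_world_perturbation_le {M : Mechanism N Ωd Ωz} {S : Fin N → ℝ}
    (hS : ∀ i, 0 ≤ S i)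
    (hpriv : SatisfiesPrivacy (fun y => (Measure.pi ν).map (transcript M y)) S) (hv : v₂ ≠ 0)
    (i : Fin N) {k : (Fin N → ℝ) × (ℕ → Fin N → Ωz) → ℝ} (hk : Measurable k) {C : ℝ}
    (hC : ∀ e, |k e| ≤ C) :
    ∫ ω, k (ω.1, worldTranscript M ω) * (ω.2.1 i / v₂) ∂(worldMeasure θ v₁ v₂ ν) ≤
      ((∫ ω, k (ω.1, worldTranscript M ω) ^ 2 ∂(worldMeasure θ v₁ v₂ ν)) + S i) / 2 := by
  obtain ⟨μ, p, hμ, hp, hI⟩ := hpriv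
  set Q : (Fin N → ℝ) → Measure (ℕ → Fin N → Ωz) := fun y => (Measure.pi ν).map (transcript M y)
  have htr : ∀ y, Measurable (transcript M y) := measurable_transcript_right M
  have hQ : ∀ y, IsProbabilityMeasure (Q y) := fun y =>
    Measure.isProbabilityMeasure_map (htr y).aemeasurable
  have hQi : ∀ (f : (ℕ → Fin N → Ωz) → ℝ), Measurable f → ∀ y,
      ∫ z, f z ∂(Q y) = ∫ δ, f (transcript M y δ) ∂(Measure.pi ν) := fun f hf y =>
    integral_map (htr y).aemeasurable hf.aestronglyMeasurable
  have hQm : ∀ (f : (ℕ → Fin N → Ωz) → ℝ), Measurable f → Measurable fun y => ∫ z, f z ∂(Q y) := by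
    intro f hf
    simp_rw [hQi f hf]
    exact (hf.comp (measurable_transcript M)).stronglyMeasurable.integral_prod_right'.measurable
  have hka : ∀ a, Measurable fun z => k (a, z) := fun a =>
    hk.comp (measurable_const.prodMk measurable_id)
  set Γ₁ : Measure (Fin N → ℝ) := Measure.pi fun _ => gaussianReal θ v₁
  set Γ₂ : Measure (Fin N → ℝ) := Measure.pi fun _ => gaussianReal 0 v₂
  have hP : worldMeasure θ v₁ v₂ ν = Γ₁.prod (Γ₂.prod (Measure.pi ν)) := rfl
  have hm : Measurable fun ω : World N Ωd => (ω.1, worldTranscript M ω) :=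
    measurable_fst.prodMk (measurable_worldTranscript M)
  have hu : Integrable (fun ω : World N Ωd => ω.2.1 i / v₂) (worldMeasure θ v₁ v₂ ν) :=
    ((memLp_world_perturbation i).integrable one_le_two).div_const _
  have hb : Integrable (fun b : Fin N → ℝ => b i / (v₂ : ℝ)) Γ₂ :=
    ((((memLp_id_gaussianReal (μ := 0) (v := v₂) 2).comp_measurePreserving
      (measurePreserving_eval (fun _ : Fin N => gaussianReal 0 v₂) i))).integrable
        one_le_two).div_const _
  have hC2 : ∀ e, ‖k e ^ 2‖ ≤ C ^ 2 := fun e => by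
    rw [norm_pow]
    exact pow_le_pow_left₀ (norm_nonneg _) (hC e) 2
  have i₁ : Integrable (fun ω : World N Ωd => k (ω.1, worldTranscript M ω) * (ω.2.1 i / v₂))
      (worldMeasure θ v₁ v₂ ν) :=
    hu.bdd_mul (c := C) (hk.comp hm).aestronglyMeasurable (ae_of_all _ fun ω => hC _)
  have i₂ : Integrable (fun ω : World N Ωd => k (ω.1, worldTranscript M ω) ^ 2)
      (worldMeasure θ v₁ v₂ ν) :=
    Integrable.of_bound ((hk.comp hm).pow_const 2).aestronglyMeasurable (C ^ 2)
      (ae_of_all _ fun ω => hC2 _)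
  have j₁ : ∀ a, Integrable (fun q : (Fin N → ℝ) × (Fin N → ℕ → Ωd) =>
      k (a, worldTranscript M (a, q)) * (q.1 i / v₂)) (Γ₂.prod (Measure.pi ν)) := fun a =>
    (hb.comp_fst _).bdd_mul (c := C)
      (hk.comp (hm.comp (measurable_const.prodMk measurable_id))).aestronglyMeasurable
      (ae_of_all _ fun ω => hC _)
  have j₂ : ∀ a, Integrable (fun q : (Fin N → ℝ) × (Fin N → ℕ → Ωd) =>
      k (a, worldTranscript M (a, q)) ^ 2) (Γ₂.prod (Measure.pi ν)) := fun a =>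
    Integrable.of_bound
      ((hk.comp (hm.comp (measurable_const.prodMk measurable_id))).pow_const 2).aestronglyMeasurable
      (C ^ 2) (ae_of_all _ fun ω => hC2 _)
  have e₁ : ∀ a, ∫ q, k (a, worldTranscript M (a, q)) * (q.1 i / v₂) ∂(Γ₂.prod (Measure.pi ν)) =
      ∫ b, b i / v₂ * ∫ z, k (a, z) ∂(Q (a + b)) ∂Γ₂ := by
    intro a
    rw [integral_prod _ (j₁ a)]
    refine integral_congr_ae (ae_of_all _ fun b => ?_)
    simp only
    rw [integral_mul_const, hQi _ (hka a), mul_comm]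
    rfl
  have e₂ : ∀ a, ∫ q, k (a, worldTranscript M (a, q)) ^ 2 ∂(Γ₂.prod (Measure.pi ν)) =
      ∫ b, ∫ z, k (a, z) ^ 2 ∂(Q (a + b)) ∂Γ₂ := by
    intro a
    rw [integral_prod _ (j₂ a)]
    refine integral_congr_ae (ae_of_all _ fun b => ?_)
    simp only
    rw [hQi _ ((hka a).pow_const 2)]
    rfl
  have hline : ∀ a, ∫ q, k (a, worldTranscript M (a, q)) * (q.1 i / v₂) ∂(Γ₂.prod (Measure.pi ν)) ≤
      ((∫ q, k (a, worldTranscript M (a, q)) ^ 2 ∂(Γ₂.prod (Measure.pi ν))) + S i) / 2 := by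
    intro a
    rw [e₁, e₂]
    exact hp.integral_gaussian_le (hS i) (hI i) (hka a) (fun z => hC _) hv (hQm _ (hka a))
      (hQm _ ((hka a).pow_const 2)) a
  rw [hP] at i₁ i₂ ⊢
  rw [integral_prod _ i₁, integral_prod _ i₂]
  calc _ ≤ ∫ a, ((∫ q, k (a, worldTranscript M (a, q)) ^ 2 ∂(Γ₂.prod (Measure.pi ν))) + S i) / 2
        ∂Γ₁ := integral_mono i₁.integral_prod_left
          ((i₂.integral_prod_left.add (integrable_const (S i))).div_const 2) hline
    _ = _ := by
        rw [integral_div, integral_add i₂.integral_prod_left (integrable_const (S i))]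
        simp

end Bound

theorem aestronglyMeasurable_of_tendsto_ae_of_measurable {Ω : Type*} {m mΩ : MeasurableSpace Ω}
    {P : Measure Ω} {f : ℕ → Ω → ℝ} {g : Ω → ℝ} (hf : ∀ n, Measurable[m] (f n))
    (h : ∀ᵐ ω ∂P, Tendsto (fun n => f n ω) atTop (𝓝 (g ω))) : AEStronglyMeasurable[m] g P := by
  refine ⟨fun ω => limUnder atTop fun n => f n ω,
    @StronglyMeasurable.limUnder ℕ Ω ℝ m _ _ atTop _ f _ _ fun n => (hf n).stronglyMeasurable, ?_⟩
  filter_upwards [h] with ω hω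
  exact hω.limUnder_eq.symm

/-! ### Assembly of the bound for a fixed splitting `y = a + b` -/

section Main

variable {N : ℕ} {Ωd Ωz : Type*} [MeasurableSpace Ωd] [MeasurableSpace Ωz]

theorem measurable_agentState (M : Mechanism N Ωd Ωz) (A : StateRule N Ωd Ωz) (i : Fin N) (k : ℕ) :
    Measurable fun q : (Fin N → ℝ) × (Fin N → ℕ → Ωd) => agentState M A q.1 q.2 i k := by
  refine (A.measurable_map i k).comp (Measurable.prodMk (by fun_prop) (Measurable.prodMk
    (by fun_prop) (measurable_pi_iff.2 fun l => ?_)))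
  exact (measurable_pi_apply _).comp (measurable_transcript M)

/-- The σ-algebra of `a` and of the whole transcript. -/
@[reducible]
def totalPublicInfo (M : Mechanism N Ωd Ωz) : MeasurableSpace (World N Ωd) :=
  ⨆ n, publicInfo M n

/-- The lower bound up to the variance of the perturbation of the average. -/
theorem sum_inv_le_integral_sq_add (hN : 2 ≤ N) {θ : ℝ} {v₁ v₂ : ℝ≥0} (hv : v₂ ≠ 0)
    {ν : Fin N → Measure (ℕ → Ωd)} [∀ i, IsProbabilityMeasure (ν i)]
    {M : Mechanism N Ωd Ωz} {S : Fin N → ℝ} (hS : ∀ i, 0 < S i)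
    (hpriv : SatisfiesPrivacy (fun y => (Measure.pi ν).map (transcript M y)) S)
    (A : StateRule N Ωd Ωz) {G : (Fin N → ℝ) × (Fin N → ℕ → Ωd) → ℝ}
    (hG : MemLp (fun q => G q - average q.1) 2
      ((Measure.pi fun _ => gaussianReal θ (v₁ + v₂)).prod (Measure.pi ν)))
    (hG0 : ∀ᵐ y ∂(Measure.pi fun _ : Fin N => gaussianReal θ (v₁ + v₂)),
      ∫ δ, (G (y, δ) - average y) ∂(Measure.pi ν) = 0)
    (hconv : ∀ i, ∃ ns : ℕ → ℕ,
      ∀ᵐ q ∂((Measure.pi fun _ => gaussianReal θ (v₁ + v₂)).prod (Measure.pi ν)),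
        Tendsto (fun k => agentState M A q.1 q.2 i (ns k)) atTop (𝓝 (G q))) :
    (1 / (N : ℝ)) ^ 2 * ∑ i, 1 / S i ≤
      ∫ q, (G q - average q.1) ^ 2
        ∂((Measure.pi fun _ => gaussianReal θ (v₁ + v₂)).prod (Measure.pi ν)) + v₂ / N := by
  have hN0 : N ≠ 0 := by omega
  have hv' : (v₂ : ℝ) ≠ 0 := by exact_mod_cast hv
  set P := worldMeasure θ v₁ v₂ ν with hP
  set ρ := (Measure.pi fun _ : Fin N => gaussianReal θ (v₁ + v₂)).prod (Measure.pi ν) with hρ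
  have hπ : MeasurePreserving (fun ω : World N Ωd => (ω.1 + ω.2.1, ω.2.2)) P ρ :=
    measurePreserving_world_add θ v₁ v₂ ν
  set r : World N Ωd → ℝ :=
    fun ω => G (ω.1 + ω.2.1, ω.2.2) - average (ω.1 + ω.2.1) with hr
  have hr2 : MemLp r 2 P := hG.comp_measurePreserving hπ
  have hrb : ∀ i, ∫ ω, r ω * ω.2.1 i ∂P = 0 :=
    integral_mul_world_perturbation_eq_zero hG hG0
  -- This equals `G - average a`. The form with `a` shows what each agent can compute; the form with
  -- `r` and `b` gives the moments.
  set W : World N Ωd → ℝ := fun ω => r ω + average ω.2.1 with hW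
  have hb2 : MemLp (fun ω : World N Ωd => average ω.2.1) 2 P := memLp_average_world_perturbation
  have hW2 : MemLp W 2 P := hr2.add hb2
  have hFle : totalPublicInfo M ≤ Prod.instMeasurableSpace := iSup_le fun n => publicInfo_le M n
  have hCI : ∀ i, CondIndepGiven P (privateInfo Ωd i) (othersInfo Ωd i) (totalPublicInfo M) :=
    condIndepGiven_iSup_publicInfo M θ v₁ v₂ ν
  have hWi : ∀ i, AEStronglyMeasurable[privateInfo Ωd i ⊔ totalPublicInfo M] W P := by
    intro i
    obtain ⟨ns, hns⟩ := hconv i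
    have h1 : AEStronglyMeasurable[privateInfo Ωd i ⊔ totalPublicInfo M]
        (fun ω => G (ω.1 + ω.2.1, ω.2.2)) P :=
      aestronglyMeasurable_of_tendsto_ae_of_measurable
        (fun n => measurable_agentState_world M A i (ns n)) (hπ.quasiMeasurePreserving.ae hns)
    have h2 : Measurable[privateInfo Ωd i ⊔ totalPublicInfo M]
        fun ω : World N Ωd => average ω.1 := by
      have h3 : Measurable[publicInfo M 0] fun ω : World N Ωd => ω.1 := comap_measurable _
      exact (measurable_average.comp h3).mono
        ((le_iSup (publicInfo M) 0).trans le_sup_right) le_rfl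
    have e : W = fun ω => G (ω.1 + ω.2.1, ω.2.2) - average ω.1 := by
      funext ω
      simp only [hW, hr, average_add]
      ring
    rw [e]
    exact h1.sub h2.stronglyMeasurable.aestronglyMeasurable
  -- Two distinct agents are needed here: `W` is computable from `F` with the data of `i₀`, and from
  -- `F` with the data of `i₁`, which belong to the complementary side.
  let i₀ : Fin N := ⟨0, by omega⟩
  let i₁ : Fin N := ⟨1, by omega⟩
  have hi : i₁ ≠ i₀ := by simp [i₀, i₁]
  have hWF : AEStronglyMeasurable[totalPublicInfo M] W P := by
    have h1 : W =ᵐ[P] P[W | totalPublicInfo M] := (hCI i₀).ae_eq_condExp (privateInfo_le i₀)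
      (othersInfo_le i₀) hFle (hW2.integrable one_le_two) (hWi i₀)
      ((hWi i₁).mono (sup_le_sup_right (privateInfo_le_othersInfo hi) _))
    exact ⟨_, stronglyMeasurable_condExp, h1⟩
  set u : Fin N → World N Ωd → ℝ := fun i ω => ω.2.1 i / v₂ with hu
  have hu2 : ∀ i, MemLp (u i) 2 P := fun i => by
    simpa only [hu, div_eq_mul_inv] using (memLp_world_perturbation i).mul_const (v₂ : ℝ)⁻¹
  have hum : ∀ i, StronglyMeasurable[privateInfo Ωd i] (u i) := fun i => by
    have h : Measurable[privateInfo Ωd i] (agentInfo i) := comap_measurable _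
    exact (h.snd.fst.div_const _).stronglyMeasurable
  have hWu : ∀ i, ∫ ω, W ω * u i ω ∂P = 1 / N := fun i => by
    have hb := memLp_world_perturbation (θ := θ) (v₁ := v₁) (v₂ := v₂) (ν := ν) i
    have e : ∀ ω, W ω * u i ω = (r ω * ω.2.1 i + average ω.2.1 * ω.2.1 i) / v₂ := fun ω => by
      simp only [hW, hu]
      ring
    have j₁ : Integrable (fun ω => r ω * ω.2.1 i) P := hr2.integrable_mul hb
    have j₂ : Integrable (fun ω : World N Ωd => average ω.2.1 * ω.2.1 i) P := hb2.integrable_mul hb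
    simp_rw [e]
    rw [integral_div, integral_add j₁ j₂, hrb, integral_average_mul_world_perturbation]
    field_simp
    ring
  have huu : ∀ i j, i ≠ j → ∫ ω, u i ω * u j ω ∂P = 0 := fun i j hij => by
    have e : ∀ ω : World N Ωd, u i ω * u j ω = ω.2.1 i * ω.2.1 j / ((v₂ : ℝ) * v₂) := fun ω => by
      simp only [hu]
      ring
    simp_rw [e]
    rw [integral_div, integral_world_perturbation_mul hij, zero_div]
  have hmain := sum_inv_le_integral_sq_of_orthogonal (P := P) (W := W)
    (T := fun i => P[u i | totalPublicInfo M]) (S := S) (c := 1 / N) hS hW2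
    (fun i => (hu2 i).condExp one_le_two)
    (fun i => by rw [integral_mul_condExp_of_memLp hFle hW2 (hu2 i) hWF, hWu])
    (fun i j hij => by
      rw [(hCI i).integral_condExp_mul_condExp (privateInfo_le i) hFle (hu2 i) (hu2 j) (hum i)
        ((hum j).mono (privateInfo_le_othersInfo hij.symm)), huu i j hij])
    (fun i => integral_condExp_sq_le
      (measurable_fst.prodMk (measurable_worldTranscript M))
      (iSup_le fun n => publicInfo_le_comap M n) (hu2 i) fun k hk hC => by
        obtain ⟨C, hC⟩ := hC
        exact integral_mul_world_perturbation_le (fun j => (hS j).le) hpriv hv i hk hC)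
  -- Pythagoras: `r` is orthogonal to every `b j`, hence to `average b`.
  have hWsq : ∫ ω, W ω ^ 2 ∂P = ∫ ω, r ω ^ 2 ∂P + v₂ / N := by
    have hrab : ∫ ω, r ω * average ω.2.1 ∂P = 0 := by
      have e : ∀ ω : World N Ωd, r ω * average ω.2.1 = ∑ j, 1 / (N : ℝ) * (r ω * ω.2.1 j) :=
        fun ω => by
          rw [average, ← Finset.mul_sum, ← Finset.mul_sum]
          ring
      have j₁ : ∀ j, Integrable (fun ω => r ω * ω.2.1 j) P := fun j =>
        hr2.integrable_mul (memLp_world_perturbation j)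
      simp_rw [e]
      rw [integral_finsetSum _ fun j _ => (j₁ j).const_mul _]
      simp only [integral_const_mul, hrb, mul_zero, Finset.sum_const_zero]
    have e : ∀ ω, W ω ^ 2 = r ω ^ 2 + average ω.2.1 ^ 2 + 2 * (r ω * average ω.2.1) := fun ω => by
      simp only [hW]
      ring
    have j₁ : Integrable (fun ω => r ω * average ω.2.1) P := hr2.integrable_mul hb2
    have j₂ : Integrable (fun ω => r ω ^ 2 + average ω.2.1 ^ 2) P :=
      hr2.integrable_sq.add hb2.integrable_sq
    simp_rw [e]
    rw [integral_add j₂ (j₁.const_mul _), integral_add hr2.integrable_sq hb2.integrable_sq,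
      integral_const_mul, hrab, integral_average_world_perturbation_sq hN0]
    ring
  have hrsq : ∫ ω, r ω ^ 2 ∂P = ∫ q, (G q - average q.1) ^ 2 ∂ρ := by
    have hm : AEStronglyMeasurable (fun q => (G q - average q.1) ^ 2) (P.map _) :=
      hπ.map_eq.symm ▸ hG.aestronglyMeasurable.pow 2
    rw [← hπ.map_eq, integral_map hπ.measurable.aemeasurable hm]
  rw [hWsq, hrsq] at hmain
  exact hmain

/-- Independence over all pairs (agent, round) is regrouped by agent: currying the infinite product
leaves a finite product of laws of whole noise sequences. -/
theorem map_noise_eq_pi {Ω : Type*} [MeasurableSpace Ω] {P : Measure Ω} [IsProbabilityMeasure P]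
    {d : Fin N → ℕ → Ω → Ωd} (hd : ∀ i k, Measurable (d i k))
    (h : iIndepFun (fun q : Fin N × ℕ => d q.1 q.2) P) :
    P.map (fun ω i k => d i k ω) = Measure.pi fun i => P.map fun ω k => d i k ω := by
  have hp : ∀ i k, IsProbabilityMeasure (P.map (d i k)) := fun i k =>
    Measure.isProbabilityMeasure_map (hd i k).aemeasurable
  have h1 := h.map_fun_eq_infinitePi_map fun q : Fin N × ℕ => hd q.1 q.2
  have h2 : ∀ i, P.map (fun ω k => d i k ω) = Measure.infinitePi fun k => P.map (d i k) := fun i =>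
    (h.precomp (g := fun k => (i, k)) (Prod.mk_right_injective i)).map_fun_eq_infinitePi_map
      fun k => hd i k
  have h3 := Measure.infinitePi_map_curry fun i k => P.map (d i k)
  rw [← h1, Measure.map_map (by fun_prop) (by fun_prop), Measure.infinitePi_eq_pi] at h3
  simp_rw [h2]
  exact h3

end Main

end PrivacyConsensus

/-! ### Transfer to the given probability space and removal of the perturbation -/

theorem theoremB1 {N : ℕ} (hN : 2 ≤ N)
    {Ω : Type*} [MeasurableSpace Ω] (P : Measure Ω) [IsProbabilityMeasure P]
    {Ωd : Type*} [MeasurableSpace Ωd] [StandardBorelSpace Ωd]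
    {Ωz : Type*} [MeasurableSpace Ωz] [StandardBorelSpace Ωz]
    -- the initial states are `y i = θ + w i` with independent `w i ∼ N(0, σ²)`
    (θ : ℝ) (σsq : ℝ≥0) (hσ : σsq ≠ 0)
    (w : Fin N → Ω → ℝ) (hw : ∀ i, Measurable (w i))
    (hwlaw : ∀ i, P.map (w i) = gaussianReal 0 σsq) (hwindep : iIndepFun w P)
    (y : Fin N → Ω → ℝ) (hy : ∀ i ω, y i ω = θ + w i ω)
    -- the privacy noises: independent, and independent of the measurement noises
    (d : Fin N → ℕ → Ω → Ωd) (hd : ∀ i k, Measurable (d i k))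
    (hdindep : iIndepFun (fun q : Fin N × ℕ => d q.1 q.2) P)
    (hwd : IndepFun (fun ω i => w i ω) (fun ω i k => d i k ω) P)
    -- the obfuscation mechanism satisfies the privacy constraints
    (M : PrivacyConsensus.Mechanism N Ωd Ωz)
    (S : Fin N → ℝ) (hS : ∀ i, 0 < S i)
    (hpriv : PrivacyConsensus.SatisfiesPrivacy (PrivacyConsensus.transcriptLaw P M d) S)
    -- the consensus algorithm: every agent's state converges to `ybar` (in probability)
    (A : PrivacyConsensus.StateRule N Ωd Ωz)
    (ybar : Ω → ℝ) (hybar : Integrable ybar P)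
    (hconv : ∀ i, TendstoInMeasure P
      (fun k ω => PrivacyConsensus.agentState M A (fun j => y j ω) (fun j l => d j l ω) i k)
      atTop ybar)
    -- `ybar` is conditionally unbiased for the average given the initial states
    (hunb : P[ybar | MeasurableSpace.comap (fun ω i => y i ω) MeasurableSpace.pi] =ᵐ[P]
      fun ω => (1 / (N : ℝ)) * ∑ i, y i ω) :
    ENNReal.ofReal ((1 / (N : ℝ) ^ 2) * ∑ i, 1 / S i) ≤
      ∫⁻ ω, ENNReal.ofReal ((ybar ω - (1 / (N : ℝ)) * ∑ i, y i ω) ^ 2) ∂P := by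
  classical
  have hyw : y = fun i ω => θ + w i ω := by
    funext i ω
    exact hy i ω
  have hym : ∀ i, Measurable (y i) := fun i => by
    rw [hyw]
    exact measurable_const.add (hw i)
  set ν : Fin N → Measure (ℕ → Ωd) := fun i => P.map fun ω k => d i k ω with hν
  have hνp : ∀ i, IsProbabilityMeasure (ν i) := fun i =>
    Measure.isProbabilityMeasure_map (by fun_prop)
  set X : Ω → (Fin N → ℝ) × (Fin N → ℕ → Ωd) := fun ω => (fun i => y i ω, fun i k => d i k ω)
    with hX
  have hYm : Measurable fun ω i => y i ω := measurable_pi_iff.2 hym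
  have hDm : Measurable fun ω i k => d i k ω := by fun_prop
  have hXm : Measurable X := hYm.prodMk hDm
  have hD : P.map (fun ω i k => d i k ω) = Measure.pi ν :=
    PrivacyConsensus.map_noise_eq_pi hd hdindep
  have hylaw : ∀ i, P.map (y i) = gaussianReal θ σsq := fun i => by
    rw [hyw, ← PrivacyConsensus.gaussianReal_map_add_left θ σsq, ← hwlaw i,
      Measure.map_map (by fun_prop) (hw i)]
    rfl
  have hyindep : iIndepFun y P := by
    rw [hyw]
    exact hwindep.comp (fun _ t => θ + t) fun _ => by fun_prop
  have hY : P.map (fun ω i => y i ω) = Measure.pi fun _ => gaussianReal θ σsq := by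
    rw [hyindep.map_fun_eq_pi_map fun i => (hym i).aemeasurable]
    simp_rw [hylaw]
  have hYD : IndepFun (fun ω i => y i ω) (fun ω i k => d i k ω) P := by
    rw [hyw]
    exact hwd.comp (φ := fun (x : Fin N → ℝ) i => θ + x i) (ψ := id) (by fun_prop) measurable_id
  set ρ := (Measure.pi fun _ : Fin N => gaussianReal θ σsq).prod (Measure.pi ν) with hρ
  have hXmp : MeasurePreserving X P ρ := by
    refine ⟨hXm, ?_⟩
    rw [hX, (indepFun_iff_map_prod_eq_prod_map_map hYm.aemeasurable hDm.aemeasurable).1 hYD, hY, hD]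
  -- the common limit as a function of initial states and noises
  obtain ⟨ns, -, hns⟩ := (hconv ⟨0, by omega⟩).exists_seq_tendsto_ae
  set G : (Fin N → ℝ) × (Fin N → ℕ → Ωd) → ℝ := fun q =>
    limUnder atTop fun k => PrivacyConsensus.agentState M A q.1 q.2 ⟨0, by omega⟩ (ns k) with hGdef
  have hGm : Measurable G := (StronglyMeasurable.limUnder fun k =>
    (PrivacyConsensus.measurable_agentState M A _ (ns k)).stronglyMeasurable).measurable
  have hGy : ∀ᵐ ω ∂P, G (X ω) = ybar ω := by
    filter_upwards [hns] with ω hω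
    exact hω.limUnder_eq
  -- Convergence in probability gives almost sure convergence only along a subsequence, which may
  -- differ between agents; only the common limit matters.
  have hGconv : ∀ i, ∃ ns : ℕ → ℕ, ∀ᵐ q ∂ρ,
      Tendsto (fun k => PrivacyConsensus.agentState M A q.1 q.2 i (ns k)) atTop (𝓝 (G q)) := by
    intro i
    obtain ⟨ms, -, hms⟩ := (hconv i).exists_seq_tendsto_ae
    refine ⟨ms, ?_⟩
    rw [← hXmp.map_eq, ae_map_iff hXm.aemeasurable (measurableSet_tendsto_fun
      (fun k => PrivacyConsensus.measurable_agentState M A i (ms k)) hGm)]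
    filter_upwards [hms, hGy] with ω hω hG
    rw [hG]
    exact hω
  have havg : Measurable fun q : (Fin N → ℝ) × (Fin N → ℕ → Ωd) =>
      PrivacyConsensus.average q.1 := PrivacyConsensus.measurable_average.comp measurable_fst
  have hRm : Measurable fun q => G q - PrivacyConsensus.average q.1 := hGm.sub havg
  have hGX : ∀ᵐ ω ∂P, G (X ω) - PrivacyConsensus.average (X ω).1 =
      ybar ω - (1 / (N : ℝ)) * ∑ i, y i ω := by
    filter_upwards [hGy] with ω hω
    rw [hω]
    rfl
  -- reduce to a finite mean square error
  set f : Ω → ℝ := fun ω => ybar ω - (1 / (N : ℝ)) * ∑ i, y i ω with hf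
  have hfm : AEStronglyMeasurable f P :=
    (hRm.comp hXm).aestronglyMeasurable.congr hGX
  by_cases hfin : ∫⁻ ω, ENNReal.ofReal (f ω ^ 2) ∂P = ⊤
  · rw [hfin]
    exact le_top
  have hfi : Integrable (fun ω => f ω ^ 2) P :=
    ⟨hfm.pow 2, (hasFiniteIntegral_iff_ofReal (ae_of_all _ fun ω => sq_nonneg _)).2
      (lt_top_iff_ne_top.2 hfin)⟩
  have hf2 : MemLp f 2 P := (memLp_two_iff_integrable_sq hfm).2 hfi
  have hG2 : MemLp (fun q => G q - PrivacyConsensus.average q.1) 2 ρ := by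
    rw [← hXmp.map_eq, memLp_map_measure_iff hRm.aestronglyMeasurable hXm.aemeasurable]
    exact hf2.ae_eq (hGX.mono fun ω hω => hω.symm)
  have hRi : Integrable (fun q => G q - PrivacyConsensus.average q.1) ρ :=
    hG2.integrable one_le_two
  -- Conditional unbiasedness becomes a statement about fibers: integrating over `{y ∈ s}` for every
  -- measurable `s` identifies the fiber integral as almost everywhere zero.
  have hG0 : ∀ᵐ y ∂(Measure.pi fun _ : Fin N => gaussianReal θ σsq),
      ∫ δ, (G (y, δ) - PrivacyConsensus.average y) ∂(Measure.pi ν) = 0 := by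
    refine ae_eq_zero_of_forall_setIntegral_eq_of_sigmaFinite
      (fun s _ _ => hRi.integral_prod_left.integrableOn) fun s hs _ => ?_
    have hsY : MeasurableSet[MeasurableSpace.comap (fun ω i => y i ω) MeasurableSpace.pi]
        ((fun ω i => y i ω) ⁻¹' s) := ⟨s, hs, rfl⟩
    have hsX : X ⁻¹' (s ×ˢ Set.univ) = (fun ω i => y i ω) ⁻¹' s := by
      ext ω
      simp [hX]
    have havi : Integrable (fun ω => (1 / (N : ℝ)) * ∑ i, y i ω) P :=
      integrable_condExp.congr hunb
    have h1 : ∫ x in s, ∫ δ, (G (x, δ) - PrivacyConsensus.average x) ∂(Measure.pi ν)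
        ∂(Measure.pi fun _ => gaussianReal θ σsq) =
        ∫ q in s ×ˢ Set.univ, (G q - PrivacyConsensus.average q.1) ∂ρ := by
      rw [hρ, setIntegral_prod _ hRi.integrableOn]
      simp only [Measure.restrict_univ]
    have h2 : ∫ q in s ×ˢ Set.univ, (G q - PrivacyConsensus.average q.1) ∂ρ =
        ∫ ω in (fun ω i => y i ω) ⁻¹' s, f ω ∂P := by
      rw [← hXmp.map_eq, setIntegral_map (hs.prod MeasurableSet.univ)
        hRm.aestronglyMeasurable hXm.aemeasurable, hsX]
      exact setIntegral_congr_ae (hYm hs) (hGX.mono fun ω hω _ => hω)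
    rw [h1, h2, hf, integral_sub hybar.integrableOn havi.integrableOn,
      ← setIntegral_condExp hYm.comap_le hybar hsY,
      setIntegral_congr_ae (hYm hs) (hunb.mono fun ω hω _ => hω), sub_self]
  have hpriv' : PrivacyConsensus.SatisfiesPrivacy
      (fun x => (Measure.pi ν).map (PrivacyConsensus.transcript M x)) S := by
    have e : PrivacyConsensus.transcriptLaw P M d =
        fun x => (Measure.pi ν).map (PrivacyConsensus.transcript M x) := by
      funext x
      rw [← hD, Measure.map_map (PrivacyConsensus.measurable_transcript_right M x) hDm]
      rfl
    rwa [e] at hpriv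
  have hlim : (1 / (N : ℝ)) ^ 2 * ∑ i, 1 / S i ≤
      ∫ q, (G q - PrivacyConsensus.average q.1) ^ 2 ∂ρ := by
    refine le_of_forall_pos_le_add fun ε hε => ?_
    -- Positive, as division by `v₂` requires; at most `σsq`, so that the truncated difference `σsq
    -- - v₂` is a genuine complementary variance; and at most `ε`, so that the loss `v₂ / N` is at
    -- most `ε`.
    set v₂ : ℝ≥0 := min ε.toNNReal σsq with hv₂
    have hv₂0 : v₂ ≠ 0 := (lt_min (Real.toNNReal_pos.2 hε) (pos_iff_ne_zero.2 hσ)).ne'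
    have hv : σsq - v₂ + v₂ = σsq := tsub_add_cancel_of_le (min_le_right _ _)
    have hb := PrivacyConsensus.sum_inv_le_integral_sq_add (N := N) (θ := θ) (v₁ := σsq - v₂)
      (v₂ := v₂) (ν := ν) hN hv₂0 hS hpriv' A (G := G) (by rwa [hv]) (by rwa [hv]) (by rwa [hv])
    rw [hv] at hb
    refine hb.trans (add_le_add_right ?_ _)
    have hle : (v₂ : ℝ) ≤ ε := by
      have : v₂ ≤ ε.toNNReal := min_le_left _ _
      calc (v₂ : ℝ) ≤ ε.toNNReal := by exact_mod_cast this
        _ = ε := Real.coe_toNNReal ε hε.le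
    have hN1 : (1 : ℝ) ≤ N := by exact_mod_cast (by omega : 1 ≤ N)
    exact (div_le_self v₂.2 hN1).trans hle
  rw [← ofReal_integral_eq_lintegral_ofReal hfi (ae_of_all _ fun ω => sq_nonneg _)]
  refine ENNReal.ofReal_le_ofReal ?_
  have hint : ∫ q, (G q - PrivacyConsensus.average q.1) ^ 2 ∂ρ = ∫ ω, f ω ^ 2 ∂P := by
    rw [← hXmp.map_eq, integral_map hXm.aemeasurable (hRm.pow_const 2).aestronglyMeasurable]
    refine integral_congr_ae (hGX.mono fun ω hω => ?_)
    simp only [hω, hf]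
  rw [← hint]
  simpa only [one_div, inv_pow] using hlim
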